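/- Let $e_1,\dots,e_7$ be the standard basis of $\mathbb R^7$. Permutations in cycle notation permute the basis vectors, and $\bar x_i=-x_i$, so that for instance $(x_1\,\bar x_5)$ sends $x_1\mapsto -x_5$, $x_5\mapsto -x_1$, and $(x_2\,\bar x_2)$ sends $x_2\mapsto -x_2$. Define in $GL_7(\mathbb R)$ $$\tilde\alpha=(x_1x_2x_4x_3x_6x_5x_7),\quad \tilde\beta=(x_3x_2x_1)(x_4x_6x_5),\quad \tilde\gamma=(x_1x_5)(x_3x_7),$$ $$\tilde\theta=(x_1x_4x_2x_5)(x_6x_7),\quad \tilde A=(x_1x_6x_2)(x_3x_5x_4),\quad \tilde B=(x_1x_3)(x_4x_6),$$ $$N_1=\mathrm{diag}(1,1,1,-1,-1,-1,-1),\ N_2=\mathrm{diag}(1,-1,-1,1,-1,-1,1),\ N_7=\mathrm{diag}(-1,1,-1,1,-1,1,-1),$$ $$N_4=N_7N_1,\quad N_6=N_7N_1N_2=\mathrm{diag}(-1,-1,1,-1,-1,1,1),\quad \delta=(x_1\bar x_5)(x_2\bar x_2)(x_3x_7)(x_4\bar x_4)(x_6).$$ Let $G=\langle\tilde\alpha,\tilde\beta,\tilde\gamma,N_1\rangle$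 and $E=\langle N_1,N_2,N_7\rangle$. Here $A:B$ denotes a split extension (semidirect product) with normal subgroup $A$ and complement $B$; $A:B:C$ means $(A:B):C$ in the case of $4:S_4:2$ (with $4$ an elementary abelian group of order 4), and $2^3:7:3$ means $2^3:(7:3)$ with $7:3$ the non-abelian group of order $21$. 1. $E$ is elementary abelian of order $8$, and $G=E:\langle\tilde\alpha,\tilde\beta,\tilde\gamma\rangle$ is a split extension $2^3:PSL_2(7)$ in which the complement acts faithfully on $E$ by conjugation. 2. $G$ has exactly five conjugacy classes of maximal subgroups. The following five are maximal subgroups of $G$, no two of them are conjugate in $G$, and every maximal subgroup of $G$ is conjugate in $G$ to one of them: - $\langle\tilde\alpha,\tilde\beta,N_1\rangle=E:(\langle\tilde\alpha\rangle:\langle\tilde\beta\rangle)$, of structure $2^3:7:3$; - $\langle\tilde\gamma,\tilde\theta,N_1\rangle=E:\langle\tilde\gamma,\tilde\theta\rangle$, of structure $2^3:S_4$; - $\langle\tilde A,\tilde B,N_1\rangle=(\langle N_2,N_4\rangle:\langle\tilde A,\tilde B\rangle):\langle N_1\rangle$, of structure $4:S_4:2$; - $\langle\tilde\alpha,\tilde\beta,\tilde\gamma\rangle$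 and $\langle\tilde\alpha,\tilde\beta,\delta\rangle$, both complements of $E$ in $G$ and both isomorphic to $PSL_2(7)$. Here $\delta\in G$ and $\tilde\gamma\delta=\delta\tilde\gamma=N_6$. 3. Under $\langle\tilde\alpha,\tilde\beta,\tilde\gamma\rangle$ the 7-space is $1+6$: the direct sum of a one-dimensional trivial and a six-dimensional irreducible subrepresentation. Under $\langle\tilde\alpha,\tilde\beta,\delta\rangle$ the 7-space is irreducible. Both hold over $\mathbb R$ and over $\mathbb C$. -/

import Mathlib

namespace Order1344

/-- The general linear group of the 7-dimensional coordinate space over `K`, written as the group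
of linear automorphisms of `K^7` under composition. The coordinates `x_1, …, x_7` of the text are
indexed here by `0, …, 6`. -/
abbrev GL7 (K : Type) [Field K] : Type := (Fin 7 → K) ≃ₗ[K] (Fin 7 → K)

/-- The signed permutation of coordinates sending the basis vector `e_i` to
`ε (σ i) • e_{σ i}`. -/
def signedPerm (K : Type) [Field K] (ε : Fin 7 → ℤˣ) (σ : Equiv.Perm (Fin 7)) : GL7 K where
  toFun v := fun j => ((ε j : ℤ) : K) * v (σ.symm j)
  invFun v := fun i => ((ε (σ i) : ℤ) : K) * v (σ i)
  map_add' v w := by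
    funext j
    simp [mul_add]
  map_smul' c v := by
    funext j
    simp [mul_left_comm]
  left_inv v := by
    funext i
    rcases Int.units_eq_one_or (ε (σ i)) with h | h <;> simp [h]
  right_inv v := by
    funext j
    rcases Int.units_eq_one_or (ε j) with h | h <;> simp [h]

/-- The permutation of coordinates `e_i ↦ e_{σ i}`. -/
def perm (K : Type) [Field K] (σ : Equiv.Perm (Fin 7)) : GL7 K := signedPerm K 1 σ

/-- The diagonal sign change with diagonal entries `ε`. -/
def diag (K : Type) [Field K] (ε : Fin 7 → ℤˣ) : GL7 K := signedPerm K ε 1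

section Generators

variable (K : Type) [Field K]

/-- `N_1 = diag(1, 1, 1, -1, -1, -1, -1)`. -/
def N1 : GL7 K := diag K ![1, 1, 1, -1, -1, -1, -1]

/-- `N_2 = diag(1, -1, -1, 1, -1, -1, 1)`. -/
def N2 : GL7 K := diag K ![1, -1, -1, 1, -1, -1, 1]

/-- `N_7 = diag(-1, 1, -1, 1, -1, 1, -1)`. -/
def N7 : GL7 K := diag K ![-1, 1, -1, 1, -1, 1, -1]

/-- `N_4 = N_7 N_1`. -/
def N4 : GL7 K := N7 K * N1 K

/-- `α̃ = (x_1 x_2 x_4 x_3 x_6 x_5 x_7)`. -/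
def alphaT : GL7 K := perm K (List.formPerm [0, 1, 3, 2, 5, 4, 6])

/-- `β̃ = (x_3 x_2 x_1)(x_4 x_6 x_5)(x_7)`. -/
def betaT : GL7 K := perm K (List.formPerm [2, 1, 0] * List.formPerm [3, 5, 4])

/-- `γ̃ = (x_1 x_5)(x_2)(x_3 x_7)(x_4)(x_6)`. -/
def gammaT : GL7 K := perm K (List.formPerm [0, 4] * List.formPerm [2, 6])

/-- `N_6 = N_7 N_1 N_2 = diag(-1, -1, 1, -1, -1, 1, 1)`. -/
def N6 : GL7 K := diag K ![-1, -1, 1, -1, -1, 1, 1]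

/-- `δ = (x_1 x̄_5)(x_2 x̄_2)(x_3 x_7)(x_4 x̄_4)(x_6)` where `x̄ = -x`: it exchanges `x_1` with
`-x_5` and `x_3` with `x_7`, changes the sign of `x_2` and `x_4`, and fixes `x_6`. -/
def delta : GL7 K :=
  signedPerm K ![-1, -1, 1, -1, -1, 1, 1] (List.formPerm [0, 4] * List.formPerm [2, 6])

/-- `θ̃ = (x_1 x_4 x_2 x_5)(x_3)(x_6 x_7)`. -/
def thetaT : GL7 K := perm K (List.formPerm [0, 3, 1, 4] * List.formPerm [5, 6])

/-- `Ã = (x_1 x_6 x_2)(x_3 x_5 x_4)(x_7)`. -/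
def AT : GL7 K := perm K (List.formPerm [0, 5, 1] * List.formPerm [2, 4, 3])

/-- `B̃ = (x_1 x_3)(x_2)(x_4 x_6)(x_5)(x_7)`. -/
def BT : GL7 K := perm K (List.formPerm [0, 2] * List.formPerm [3, 5])

/-- The group `2^3:PSL_2(7)` acting on `K^7`: it is generated by `α̃, β̃, γ̃, N_1`. -/
def G : Subgroup (GL7 K) := Subgroup.closure {alphaT K, betaT K, gammaT K, N1 K}

/-- The group `2^3` of diagonal matrices, generated by `N_1, N_2, N_7`. -/
def E8 : Subgroup (GL7 K) := Subgroup.closure {N1 K, N2 K, N7 K}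

/-- The four-group `{1, N_2, N_4, N_6}`, generated by `N_2` and `N_4`. -/
def E4 : Subgroup (GL7 K) := Subgroup.closure {N2 K, N4 K}

/-- The subgroup `⟨α̃, β̃, γ̃⟩`. -/
def P : Subgroup (GL7 K) := Subgroup.closure {alphaT K, betaT K, gammaT K}

/-- The subgroup `⟨α̃, β̃, δ⟩`. -/
def Q : Subgroup (GL7 K) := Subgroup.closure {alphaT K, betaT K, delta K}

/-- The subgroup `⟨α̃, β̃⟩`. -/
def F21 : Subgroup (GL7 K) := Subgroup.closure {alphaT K, betaT K}

/-- The subgroup `⟨γ̃, θ̃⟩`, which permutes `{x_3, x_6, x_7}` and centralizes `N_6`. -/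
def S : Subgroup (GL7 K) := Subgroup.closure {gammaT K, thetaT K}

/-- The subgroup `⟨Ã, B̃⟩`, which fixes the coordinate `x_7` and normalizes `{1, N_2, N_4, N_6}`. -/
def T : Subgroup (GL7 K) := Subgroup.closure {AT K, BT K}

/-- The subgroup `⟨α̃, β̃, N_1⟩`, of shape `2^3:7:3`. -/
def M1 : Subgroup (GL7 K) := Subgroup.closure {alphaT K, betaT K, N1 K}

/-- The subgroup `⟨γ̃, θ̃, N_1⟩`, of shape `2^3:S_4`. -/
def M2 : Subgroup (GL7 K) := Subgroup.closure {gammaT K, thetaT K, N1 K}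

/-- The subgroup `⟨Ã, B̃, N_1⟩`, of shape `4:S_4:2`. -/
def M3 : Subgroup (GL7 K) := Subgroup.closure {AT K, BT K, N1 K}

/-- The five representatives: `2^3:7:3`, `2^3:S_4`, `4:S_4:2`, `⟨α̃, β̃, γ̃⟩`, `⟨α̃, β̃, δ⟩`. -/
def maxRep : Fin 5 → Subgroup (GL7 K) := ![M1 K, M2 K, M3 K, P K, Q K]

end Generators

/-- `H` is the (internal) split extension `A:B`: the subgroup `A` of `H` is normal in `H`, and the
subgroup `B` of `H` is a complement of `A` in `H`. -/
def IsSplitExtension {X : Type} [Group X] (H A B : Subgroup X) : Prop :=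
  (A.subgroupOf H).Normal ∧ A ⊓ B = ⊥ ∧ A ⊔ B = H

/-- The group `A` is elementary abelian of order `2^n`. -/
def IsElementaryTwo (A : Type) [Group A] (n : ℕ) : Prop :=
  Nonempty (A ≃* Multiplicative (Fin n → ZMod 2))

/-- The subgroups `A` and `B` are conjugate by an element of `H`. -/
def ConjugateIn {X : Type} [Group X] (H A B : Subgroup X) : Prop :=
  ∃ g ∈ H, A.map (MulAut.conj g).toMonoidHom = B

/-- The tautological representation on `K^7` of a subgroup of `GL_7(K)`. -/
def natRep {K : Type} [Field K] (H : Subgroup (GL7 K)) : Representation K H (Fin 7 → K) :=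
  (LinearEquiv.automorphismGroup.toLinearMapMonoidHom).comp H.subtype

/-- The space `K^7` is, under `H`, the direct sum `1 + 6` of a one-dimensional trivial and a
six-dimensional irreducible subrepresentation. -/
def DecomposesAsOneAddSix {K : Type} [Field K] (H : Subgroup (GL7 K)) : Prop :=
  ∃ L W : Subrepresentation (natRep H),
    IsCompl L.toSubmodule W.toSubmodule ∧
    Module.finrank K L.toSubmodule = 1 ∧ L.toRepresentation.IsTrivial ∧
    Module.finrank K W.toSubmodule = 6 ∧ W.toRepresentation.IsIrreducible

end Order1344

/-!
The group `G` consists of signed permutations of the seven coordinates, so everything that does not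
mention subspaces is proved in the semidirect product `SignedPerm` of sign vectors and permutations,
where identities between explicit elements are decidable, and carried over to `GL_7` along the
injective homomorphism `toGL`.

The kernel of `G → Perm (Fin 7)` is `E = 2^3`, and the image `L` is `PSL_2(7)`. The element `α̃`
permutes the seven involutions of `E` transitively, so `E` is an irreducible `L`-module.

*Order.* The relations between `α̃`, `β̃` and `γ̃` show that `L` is the union of `7:3` and one
double coset, so that `|L| ≤ 21 + 147 = 168` (`BruhatRelations.exists_of_mem_closure`); it contains `S_4`
and an element of order 7. As `δ` satisfies the same relations, `⟨α̃, β̃, δ⟩` is a complement too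
(`E_inf_Q`).

*Maximal subgroups containing `E`* correspond to those of `L`. A proper subgroup of `L` of order
divisible by 7 lies in the normalizer `7:3` of a Sylow 7-subgroup, because `7:3` and any further
element generate `L`. If the order is divisible by 3 but not by 7, the subgroup contains `β̃` up to
conjugacy, and each of its elements fixes the coordinate or the involution of `E` fixed by `β̃`; as
a group is not a union of two proper subgroups, it lies in one of the two stabilizers, which are the
two `S_4`. A 2-group fixes one of the seven coordinates (`isConjSmall_of_ne`).

*Maximal subgroups not containing `E`* are complements of `E`, since `E` is irreducible. Up to
conjugacy such a complement contains `α̃`, then `β̃`, and then an element of `E γ̃` which its order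
and that of its product with `β̃ α̃` restrict to `γ̃` and `δ` (`exists_conj_of_complement`).

*The isomorphism with `PSL_2(7)`.* The group `G` acts as an affine group on the eight sign vectors
in the orbit of the all-ones vector. Labelled by the projective line over the field with 7 elements,
`⟨α̃, β̃, δ⟩` acts on them by fractional linear maps (`nonempty_equiv_Q`); orders agree.

*The 7-space.* The sum over part of the stabilizer of the last coordinate turns an arbitrary vector
into a known multiple of one vector, `7 e_7 - 1` on the hyperplane of vectors with coordinate sum
zero for `⟨α̃, β̃, γ̃⟩`, and `e_7` for `⟨α̃, β̃, δ⟩`, whose images under the powers of `α̃` span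
(`sumZero_le_of_invariant`, `isIrreducible_natRep_Q`).
-/

namespace Order1344

/-! ### Signed permutations -/

/-- The group of signed permutations of seven coordinates: a pair `⟨ε, σ⟩` stands for the map
`e_i ↦ ε (σ i) • e_{σ i}`. -/
abbrev SignedPerm : Type := (Fin 7 → ℤˣ) ⋊[mulAutArrow] Equiv.Perm (Fin 7)

/-- Equality of signed permutations is tested componentwise and pointwise, which evaluates well. -/
instance : DecidableEq SignedPerm := fun _ _ =>
  decidable_of_iff _ SemidirectProduct.ext_iff.symm

instance : Finite SignedPerm := Finite.of_equiv _ SemidirectProduct.equivProd.symm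

/-- The action of signed permutations on `K^7`. -/
def toGL (K : Type) [Field K] : SignedPerm →* GL7 K where
  toFun w := signedPerm K w.left w.right
  map_one' := by
    ext1 v
    funext j
    simp [signedPerm]
    rfl
  map_mul' x y := by
    ext1 v
    funext j
    simp [signedPerm, mul_assoc]
    exact Or.inl rfl

lemma toGL_apply (K : Type) [Field K] (w : SignedPerm) (v : Fin 7 → K) (j : Fin 7) :
    toGL K w v j = ((w.left j : ℤ) : K) * v (w.right⁻¹ j) := rfl

lemma toGL_injective (K : Type) [Field K] [CharZero K] : Function.Injective (toGL K) := by
  rw [injective_iff_map_eq_one]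
  intro w hw
  have key : ∀ i j, ((w.left j : ℤ) : K) * (Pi.single i 1 : Fin 7 → K) (w.right⁻¹ j)
      = (Pi.single i 1 : Fin 7 → K) j := fun i j => by
    rw [← toGL_apply, hw]
    rfl
  have hr : w.right⁻¹ = 1 := by
    ext1 j
    by_contra hne
    rw [Equiv.Perm.one_apply] at hne
    have := key j j
    rw [Pi.single_eq_of_ne hne] at this
    simp at this
  refine SemidirectProduct.ext ?_ (inv_eq_one.mp hr)
  funext j
  have := key j j
  rw [hr] at this
  simp only [Equiv.Perm.coe_one, id_eq, Pi.single_eq_same, mul_one] at this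
  exact Units.ext (by exact_mod_cast this : ((w.left j : ℤˣ) : ℤ) = 1)

namespace SignedPerm

/-- The permutation `(x_1 x_2 x_4 x_3 x_6 x_5 x_7)`. -/
def pa : Equiv.Perm (Fin 7) where
  toFun := ![1, 3, 5, 2, 6, 4, 0]
  invFun := ![6, 0, 3, 1, 5, 2, 4]
  left_inv := by decide
  right_inv := by decide

/-- The permutation `(x_3 x_2 x_1)(x_4 x_6 x_5)`. -/
def pb : Equiv.Perm (Fin 7) where
  toFun := ![2, 0, 1, 5, 3, 4, 6]
  invFun := ![1, 2, 0, 4, 5, 3, 6]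
  left_inv := by decide
  right_inv := by decide

/-- The permutation `(x_1 x_5)(x_3 x_7)`. -/
def pc : Equiv.Perm (Fin 7) where
  toFun := ![4, 1, 6, 3, 0, 5, 2]
  invFun := ![4, 1, 6, 3, 0, 5, 2]
  left_inv := by decide
  right_inv := by decide

/-- The permutation `(x_1 x_4 x_2 x_5)(x_6 x_7)`. -/
def pt : Equiv.Perm (Fin 7) where
  toFun := ![3, 4, 2, 1, 0, 6, 5]
  invFun := ![4, 3, 2, 0, 1, 6, 5]
  left_inv := by decide
  right_inv := by decide

/-- The permutation `(x_1 x_6 x_2)(x_3 x_5 x_4)`. -/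
def pA : Equiv.Perm (Fin 7) where
  toFun := ![5, 0, 4, 2, 3, 1, 6]
  invFun := ![1, 5, 3, 4, 2, 0, 6]
  left_inv := by decide
  right_inv := by decide

/-- The permutation `(x_1 x_3)(x_4 x_6)`. -/
def pB : Equiv.Perm (Fin 7) where
  toFun := ![2, 1, 0, 5, 4, 3, 6]
  invFun := ![2, 1, 0, 5, 4, 3, 6]
  left_inv := by decide
  right_inv := by decide

/-- The pure permutation with underlying permutation `σ`. -/
abbrev ofPerm : Equiv.Perm (Fin 7) →* SignedPerm := SemidirectProduct.inr

/-- The pure sign change `ε`. -/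
abbrev ofSigns : (Fin 7 → ℤˣ) →* SignedPerm := SemidirectProduct.inl

/-- The underlying permutation of a signed permutation. -/
abbrev toPerm : SignedPerm →* Equiv.Perm (Fin 7) := SemidirectProduct.rightHom

/-- The signed permutation inducing `α̃`. -/
def a : SignedPerm := ofPerm pa
/-- The signed permutation inducing `β̃`. -/
def b : SignedPerm := ofPerm pb
/-- The signed permutation inducing `γ̃`. -/
def c : SignedPerm := ofPerm pc
/-- The signed permutation inducing `θ̃`. -/
def t : SignedPerm := ofPerm pt
/-- The signed permutation inducing `Ã`. -/
def A : SignedPerm := ofPerm pA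
/-- The signed permutation inducing `B̃`. -/
def B : SignedPerm := ofPerm pB
/-- The signed permutation inducing `N_1`. -/
def n1 : SignedPerm := ofSigns ![1, 1, 1, -1, -1, -1, -1]
/-- The signed permutation inducing `N_2`. -/
def n2 : SignedPerm := ofSigns ![1, -1, -1, 1, -1, -1, 1]
/-- The signed permutation inducing `N_7`. -/
def n7 : SignedPerm := ofSigns ![-1, 1, -1, 1, -1, 1, -1]
/-- The signed permutation inducing `N_6`. -/
def n6 : SignedPerm := ofSigns ![-1, -1, 1, -1, -1, 1, 1]
/-- The signed permutation inducing `δ`. -/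
def d : SignedPerm := ⟨![-1, -1, 1, -1, -1, 1, 1], pc⟩

/-- The group `2^3:PSL_2(7)` of signed permutations. -/
def G : Subgroup SignedPerm := Subgroup.closure {a, b, c, n1}
/-- The group `2^3` of sign changes. -/
def E : Subgroup SignedPerm := Subgroup.closure {n1, n2, n7}
/-- The four-group of sign changes generated by `N_2` and `N_4 = N_7 N_1`. -/
def E4 : Subgroup SignedPerm := Subgroup.closure {n2, n7 * n1}
/-- The permutation complement of `2^3`. -/
def P : Subgroup SignedPerm := Subgroup.closure {a, b, c}
/-- The complement of `2^3` acting irreducibly. -/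
def Q : Subgroup SignedPerm := Subgroup.closure {a, b, d}
/-- The group `7:3`. -/
def F : Subgroup SignedPerm := Subgroup.closure {a, b}
/-- The group `S_4` with orbits of lengths 3 and 4 on the coordinates. -/
def S : Subgroup SignedPerm := Subgroup.closure {c, t}
/-- The group `S_4` with orbits of lengths 6 and 1 on the coordinates. -/
def T : Subgroup SignedPerm := Subgroup.closure {A, B}
/-- The group `2^3:7:3`. -/
def M1 : Subgroup SignedPerm := Subgroup.closure {a, b, n1}
/-- The group `2^3:S_4` fixing `N_6`. -/
def M2 : Subgroup SignedPerm := Subgroup.closure {c, t, n1}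
/-- The group `2^3:S_4` fixing the last coordinate up to sign. -/
def M3 : Subgroup SignedPerm := Subgroup.closure {A, B, n1}

/-- The five representatives of the classes of maximal subgroups. -/
def maxRep : Fin 5 → Subgroup SignedPerm := ![M1, M2, M3, P, Q]

end SignedPerm

section Transfer

variable (K : Type) [Field K]

lemma toGL_a : toGL K SignedPerm.a = alphaT K :=
  congrArg (perm K) (by decide +kernel : SignedPerm.pa = _)

lemma toGL_b : toGL K SignedPerm.b = betaT K :=
  congrArg (perm K) (by decide +kernel : SignedPerm.pb = _)

lemma toGL_c : toGL K SignedPerm.c = gammaT K :=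
  congrArg (perm K) (by decide +kernel : SignedPerm.pc = _)

lemma toGL_t : toGL K SignedPerm.t = thetaT K :=
  congrArg (perm K) (by decide +kernel : SignedPerm.pt = _)

lemma toGL_A : toGL K SignedPerm.A = AT K :=
  congrArg (perm K) (by decide +kernel : SignedPerm.pA = _)

lemma toGL_B : toGL K SignedPerm.B = BT K :=
  congrArg (perm K) (by decide +kernel : SignedPerm.pB = _)

lemma toGL_d : toGL K SignedPerm.d = delta K :=
  congrArg (signedPerm K _) (by decide +kernel : SignedPerm.pc = _)

lemma map_G : SignedPerm.G.map (toGL K) = G K := by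
  simp only [SignedPerm.G, MonoidHom.map_closure, Set.image_insert_eq, Set.image_singleton,
    toGL_a, toGL_b, toGL_c]
  rfl

lemma map_E : SignedPerm.E.map (toGL K) = E8 K := by
  simp only [SignedPerm.E, MonoidHom.map_closure, Set.image_insert_eq, Set.image_singleton]
  rfl

lemma map_E4 : SignedPerm.E4.map (toGL K) = E4 K := by
  simp only [SignedPerm.E4, MonoidHom.map_closure, Set.image_insert_eq, Set.image_singleton,
    map_mul]
  rfl

lemma map_P : SignedPerm.P.map (toGL K) = P K := by
  simp only [SignedPerm.P, MonoidHom.map_closure, Set.image_insert_eq, Set.image_singleton,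
    toGL_a, toGL_b, toGL_c]
  rfl

lemma map_Q : SignedPerm.Q.map (toGL K) = Q K := by
  simp only [SignedPerm.Q, MonoidHom.map_closure, Set.image_insert_eq, Set.image_singleton,
    toGL_a, toGL_b, toGL_d]
  rfl

lemma map_F : SignedPerm.F.map (toGL K) = F21 K := by
  simp only [SignedPerm.F, MonoidHom.map_closure, Set.image_insert_eq, Set.image_singleton,
    toGL_a, toGL_b]
  rfl

lemma map_S : SignedPerm.S.map (toGL K) = S K := by
  simp only [SignedPerm.S, MonoidHom.map_closure, Set.image_insert_eq, Set.image_singleton,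
    toGL_c, toGL_t]
  rfl

lemma map_T : SignedPerm.T.map (toGL K) = T K := by
  simp only [SignedPerm.T, MonoidHom.map_closure, Set.image_insert_eq, Set.image_singleton,
    toGL_A, toGL_B]
  rfl

lemma map_M1 : SignedPerm.M1.map (toGL K) = M1 K := by
  simp only [SignedPerm.M1, MonoidHom.map_closure, Set.image_insert_eq, Set.image_singleton,
    toGL_a, toGL_b]
  rfl

lemma map_M2 : SignedPerm.M2.map (toGL K) = M2 K := by
  simp only [SignedPerm.M2, MonoidHom.map_closure, Set.image_insert_eq, Set.image_singleton,
    toGL_c, toGL_t]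
  rfl

lemma map_M3 : SignedPerm.M3.map (toGL K) = M3 K := by
  simp only [SignedPerm.M3, MonoidHom.map_closure, Set.image_insert_eq, Set.image_singleton,
    toGL_A, toGL_B]
  rfl

lemma map_maxRep (i : Fin 5) : (SignedPerm.maxRep i).map (toGL K) = maxRep K i := by
  fin_cases i
  exacts [map_M1 K, map_M2 K, map_M3 K, map_P K, map_Q K]

variable {X Y : Type} [Group X] [Group Y] {f : X →* Y}

lemma IsSplitExtension.map (hf : Function.Injective f) {H A B : Subgroup X}
    (h : IsSplitExtension H A B) : IsSplitExtension (H.map f) (A.map f) (B.map f) := by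
  obtain ⟨h1, h2, h3⟩ := h
  refine ⟨⟨?_⟩, by rw [← Subgroup.map_inf _ _ _ hf, h2, Subgroup.map_bot],
    by rw [← Subgroup.map_sup, h3]⟩
  rintro ⟨_, n, hn, rfl⟩ hnA ⟨_, g, hg, rfl⟩
  obtain ⟨n', hn', e⟩ := hnA
  obtain rfl := hf e
  exact ⟨g * n' * g⁻¹, h1.conj_mem ⟨n', hn⟩ hn' ⟨g, hg⟩, by simp⟩

/-- In a group generated by `A` and `B` where `B` normalizes `A`, trivial intersection is all that
is needed for a split extension. -/
lemma isSplitExtension_of_le_normalizer {H A B : Subgroup X} (hB : B ≤ Subgroup.normalizer A)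
    (hinf : A ⊓ B = ⊥) (hsup : A ⊔ B = H) : IsSplitExtension H A B := by
  refine ⟨?_, hinf, hsup⟩
  rw [Subgroup.normal_subgroupOf_iff_le_normalizer (hsup ▸ le_sup_left), ← hsup]
  exact sup_le Subgroup.le_normalizer hB

lemma ConjugateIn.of_map (hf : Function.Injective f) {H A B : Subgroup X}
    (h : ConjugateIn (H.map f) (A.map f) (B.map f)) : ConjugateIn H A B := by
  obtain ⟨_, ⟨g, hg, rfl⟩, h⟩ := h
  refine ⟨g, hg, Subgroup.map_injective hf ?_⟩
  rw [← h, Subgroup.map_map, Subgroup.map_map]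
  congr 1
  ext x
  simp

lemma ConjugateIn.map (f : X →* Y) {H A B : Subgroup X}
    (h : ConjugateIn H A B) : ConjugateIn (H.map f) (A.map f) (B.map f) := by
  obtain ⟨g, hg, rfl⟩ := h
  refine ⟨f g, ⟨g, hg, rfl⟩, ?_⟩
  rw [Subgroup.map_map, Subgroup.map_map]
  congr 1
  ext x
  simp

lemma covBy_map_iff (hf : Function.Injective f) {A H : Subgroup X} :
    A.map f ⋖ H.map f ↔ A ⋖ H := by
  refine Set.OrdConnected.apply_covBy_apply_iff
    (OrderEmbedding.ofMapLEIff (Subgroup.map f) fun _ _ => Subgroup.map_le_map_iff_of_injective hf)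
    ⟨?_⟩
  rintro _ _ _ ⟨C, rfl⟩ D ⟨_, hD⟩
  exact ⟨D.comap f, Subgroup.map_comap_eq_self (hD.trans (Subgroup.map_le_range _ _))⟩

lemma exists_map_eq_of_le {M : Subgroup Y} {H : Subgroup X} (h : M ≤ H.map f) :
    ∃ N : Subgroup X, N.map f = M :=
  ⟨M.comap f, Subgroup.map_comap_eq_self (h.trans (Subgroup.map_le_range _ _))⟩

end Transfer

namespace SignedPerm

/-! ### The elementary abelian group of sign changes -/

/-- The parametrization `(i, j, k) ↦ N_1^i N_2^j N_7^k` of the group `2^3`. -/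
def signHom : Multiplicative (Fin 3 → ZMod 2) →* SignedPerm where
  toFun v := n1 ^ (v.toAdd 0).val * n2 ^ (v.toAdd 1).val * n7 ^ (v.toAdd 2).val
  map_one' := by decide +kernel
  map_mul' := by decide +kernel

lemma signHom_injective : Function.Injective signHom := by decide +kernel

lemma range_signHom : signHom.range = E := by
  refine le_antisymm ?_ ((Subgroup.closure_le _).2 ?_)
  · rintro _ ⟨v, rfl⟩
    have h1 : n1 ∈ E := Subgroup.subset_closure (by simp)
    have h2 : n2 ∈ E := Subgroup.subset_closure (by simp)
    have h7 : n7 ∈ E := Subgroup.subset_closure (by simp)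
    exact mul_mem (mul_mem (pow_mem h1 _) (pow_mem h2 _)) (pow_mem h7 _)
  · rintro _ (rfl | rfl | rfl)
    exacts [⟨.ofAdd ![1, 0, 0], by decide +kernel⟩, ⟨.ofAdd ![0, 1, 0], by decide +kernel⟩,
      ⟨.ofAdd ![0, 0, 1], by decide +kernel⟩]

lemma mem_E_iff {x : SignedPerm} : x ∈ E ↔ ∃ v, signHom v = x := by
  rw [← range_signHom, MonoidHom.mem_range]

lemma isElementaryTwo_E : IsElementaryTwo E 3 :=
  ⟨((MonoidHom.ofInjective signHom_injective).trans
    (MulEquiv.subgroupCongr range_signHom)).symm⟩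

/-- The parametrization `(i, j) ↦ N_2^i N_4^j` of the four-group. -/
def signHom4 : Multiplicative (Fin 2 → ZMod 2) →* SignedPerm where
  toFun v := n2 ^ (v.toAdd 0).val * (n7 * n1) ^ (v.toAdd 1).val
  map_one' := by decide +kernel
  map_mul' := by decide +kernel

lemma signHom4_injective : Function.Injective signHom4 := by decide +kernel

lemma range_signHom4 : signHom4.range = E4 := by
  refine le_antisymm ?_ ((Subgroup.closure_le _).2 ?_)
  · rintro _ ⟨v, rfl⟩
    have h2 : n2 ∈ E4 := Subgroup.subset_closure (by simp)
    have h4 : n7 * n1 ∈ E4 := Subgroup.subset_closure (by simp)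
    exact mul_mem (pow_mem h2 _) (pow_mem h4 _)
  · rintro _ (rfl | rfl)
    exacts [⟨.ofAdd ![1, 0], by decide +kernel⟩, ⟨.ofAdd ![0, 1], by decide +kernel⟩]

lemma mem_E4_iff {x : SignedPerm} : x ∈ E4 ↔ ∃ v, signHom4 v = x := by
  rw [← range_signHom4, MonoidHom.mem_range]

lemma isElementaryTwo_E4 : IsElementaryTwo E4 2 :=
  ⟨((MonoidHom.ofInjective signHom4_injective).trans
    (MulEquiv.subgroupCongr range_signHom4)).symm⟩

lemma E_le_ker : E ≤ toPerm.ker := by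
  intro x hx
  obtain ⟨v, rfl⟩ := mem_E_iff.1 hx
  have : ∀ v, toPerm (signHom v) = 1 := by decide +kernel
  exact this v

lemma E_inf_range_ofPerm : E ⊓ ofPerm.range = ⊥ := by
  rw [eq_bot_iff]
  rintro _ ⟨hx, σ, rfl⟩
  have : σ = 1 := by simpa using MonoidHom.mem_ker.1 (E_le_ker hx)
  simp [this]

lemma mem_normalizer_E {x : SignedPerm} (h : ∀ v, ∃ v', x * signHom v * x⁻¹ = signHom v') :
    x ∈ Subgroup.normalizer E := by
  refine Subgroup.mem_normalizer_fintype fun y hy => ?_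
  obtain ⟨v, rfl⟩ := mem_E_iff.1 hy
  obtain ⟨v', hv⟩ := h v
  exact mem_E_iff.2 ⟨v', hv.symm⟩

lemma G_le_normalizer_E : G ≤ Subgroup.normalizer E := by
  refine (Subgroup.closure_le _).2 ?_
  rintro _ (rfl | rfl | rfl | rfl) <;> exact mem_normalizer_E (by decide +kernel)

lemma conj_mem_E {g e : SignedPerm} (hg : g ∈ G) (he : e ∈ E) : g * e * g⁻¹ ∈ E :=
  (G_le_normalizer_E hg e).1 he

/-- `α̃` permutes the seven involutions of `E` transitively. -/
lemma exists_pow_conj_eq {x y : SignedPerm} (hx : x ∈ E) (hx1 : x ≠ 1) (hy : y ∈ E)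
    (hy1 : y ≠ 1) : ∃ k : Fin 7, a ^ (k : ℕ) * x * (a ^ (k : ℕ))⁻¹ = y := by
  obtain ⟨v, rfl⟩ := mem_E_iff.1 hx
  obtain ⟨w, rfl⟩ := mem_E_iff.1 hy
  revert v w
  have : ∀ v, signHom v ≠ 1 → ∀ w, signHom w ≠ 1 →
      ∃ k : Fin 7, a ^ (k : ℕ) * signHom v * (a ^ (k : ℕ))⁻¹ = signHom w := by decide +kernel
  exact fun v _ hv w _ hw => this v hv w hw

/-- A subgroup of `E` normalized by `α̃` is trivial or equal to `E`. -/
lemma E_le_of_conj_mem {H : Subgroup SignedPerm} {x : SignedPerm} (hx : x ∈ E) (hx1 : x ≠ 1)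
    (hxH : x ∈ H) (h : ∀ y ∈ E, y ∈ H → a * y * a⁻¹ ∈ H) : E ≤ H := by
  have ha : a ∈ G := Subgroup.subset_closure (by simp)
  have key : ∀ k : ℕ, a ^ k * x * (a ^ k)⁻¹ ∈ H := by
    intro k
    induction k with
    | zero => simpa using hxH
    | succ k ih =>
      have := h _ (conj_mem_E (pow_mem ha k) hx) ih
      simpa [pow_succ', mul_assoc] using this
  intro y hy
  rcases eq_or_ne y 1 with rfl | hy1
  · exact one_mem H
  · obtain ⟨k, rfl⟩ := exists_pow_conj_eq hx hx1 hy hy1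
    exact key k

lemma n1_mem_E : n1 ∈ E := Subgroup.subset_closure (by simp)

lemma n2_mem_E : n2 ∈ E := Subgroup.subset_closure (by simp)

lemma n7_mem_E : n7 ∈ E := Subgroup.subset_closure (by simp)

lemma n6_mem_E : n6 ∈ E := mem_E_iff.2 ⟨.ofAdd ![1, 1, 1], by decide +kernel⟩

lemma n1_ne_one : n1 ≠ 1 := by decide +kernel

lemma E_le_of_a_mem {H : Subgroup SignedPerm} (ha : a ∈ H) (h1 : n1 ∈ H) : E ≤ H :=
  E_le_of_conj_mem n1_mem_E n1_ne_one h1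
    fun _ _ hy => mul_mem (mul_mem ha hy) (inv_mem ha)

lemma E_le_G : E ≤ G :=
  E_le_of_a_mem (Subgroup.subset_closure (by simp)) (Subgroup.subset_closure (by simp))

lemma P_le_G : P ≤ G := Subgroup.closure_mono (by simp [Set.insert_subset_iff])

lemma a_mem_P : a ∈ P := Subgroup.subset_closure (by simp)

lemma b_mem_P : b ∈ P := Subgroup.subset_closure (by simp)

lemma c_mem_P : c ∈ P := Subgroup.subset_closure (by simp)

lemma E_sup_P : E ⊔ P = G := by
  refine le_antisymm (sup_le E_le_G P_le_G) ((Subgroup.closure_le _).2 ?_)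
  rintro _ (rfl | rfl | rfl | rfl)
  exacts [Subgroup.mem_sup_right a_mem_P, Subgroup.mem_sup_right b_mem_P,
    Subgroup.mem_sup_right c_mem_P, Subgroup.mem_sup_left n1_mem_E]

lemma P_le_range_ofPerm : P ≤ ofPerm.range := by
  refine (Subgroup.closure_le _).2 ?_
  rintro _ (rfl | rfl | rfl)
  exacts [⟨_, rfl⟩, ⟨_, rfl⟩, ⟨_, rfl⟩]

lemma E_inf_P : E ⊓ P = ⊥ :=
  eq_bot_mono (inf_le_inf_left _ P_le_range_ofPerm) E_inf_range_ofPerm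

lemma isSplitExtension_P : IsSplitExtension G E P :=
  isSplitExtension_of_le_normalizer (P_le_G.trans G_le_normalizer_E) E_inf_P E_sup_P

lemma mem_sup_of_le_normalizer {X : Type*} [Group X] {A B : Subgroup X}
    (h : B ≤ Subgroup.normalizer A) {x : X} : x ∈ A ⊔ B ↔ ∃ y ∈ A, ∃ z ∈ B, y * z = x := by
  rw [← SetLike.mem_coe, Subgroup.coe_mul_of_right_le_normalizer_left _ _ h, Set.mem_mul]
  rfl

/-- The coordinates are separated by the sign changes in `E`, so that a permutation commuting with
all of `E` is trivial. -/
lemma eq_one_of_commute_E {g : SignedPerm} (hg : g ∈ ofPerm.range)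
    (h : ∀ e ∈ E, g * e = e * g) : g = 1 := by
  obtain ⟨σ, rfl⟩ := hg
  have key : ∀ ε : Fin 7 → ℤˣ, ofSigns ε ∈ E → ∀ j, ε (σ j) = ε j := by
    intro ε hε j
    have h1 : (ofPerm σ * ofSigns ε).left (σ j) = ε j := by
      change 1 * ε (σ⁻¹ (σ j)) = ε j
      simp
    have h2 : (ofSigns ε * ofPerm σ).left (σ j) = ε (σ j) := by simp
    rw [← h1, ← h2, h _ hε]
  have sep : ∀ i j : Fin 7, (![1, 1, 1, -1, -1, -1, -1] : Fin 7 → ℤˣ) i =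
      (![1, 1, 1, -1, -1, -1, -1] : Fin 7 → ℤˣ) j →
      (![1, -1, -1, 1, -1, -1, 1] : Fin 7 → ℤˣ) i = (![1, -1, -1, 1, -1, -1, 1] : Fin 7 → ℤˣ) j →
      (![-1, 1, -1, 1, -1, 1, -1] : Fin 7 → ℤˣ) i =
      (![-1, 1, -1, 1, -1, 1, -1] : Fin 7 → ℤˣ) j → i = j := by decide
  have : σ = 1 := by
    ext1 j
    exact sep _ _ (key _ n1_mem_E j) (key _ n2_mem_E j) (key _ n7_mem_E j)
  simp [this]

end SignedPerm

/-! ### The double coset decomposition of `PSL_2(7)` -/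

section Bruhat

variable {X : Type*} [Group X]

/-- The relations satisfied by `α̃, β̃` and each of the involutions `γ̃`, `δ`: those of `7:3`, and
the ones rewriting `c b` and `c a^k c` in the form `a^i b^j` or `a^i b^j c a^l`. -/
structure BruhatRelations (a b c : X) : Prop where
  a_pow : a ^ 7 = 1
  b_pow : b ^ 3 = 1
  b_mul_a : b * a = a ^ 4 * b
  c_mul_b : c * b = a ^ 4 * b ^ 2 * c * a ^ 4
  c_mul_c : c * c = 1
  c_mul_pow_mul_c : ∀ k : Fin 6, c * a ^ (k + 1 : ℕ) * c =
    a ^ ((![2, 4, 4, 3, 6, 6] : Fin 6 → ℕ) k) * b ^ ((![2, 1, 0, 0, 1, 2] : Fin 6 → ℕ) k) * c *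
      a ^ ((![5, 6, 4, 3, 1, 2] : Fin 6 → ℕ) k)

namespace BruhatRelations

variable {a b c : X}

lemma map {Y : Type*} [Group Y] (f : X →* Y) (h : BruhatRelations a b c) :
    BruhatRelations (f a) (f b) (f c) where
  a_pow := by simpa using congrArg f h.a_pow
  b_pow := by simpa using congrArg f h.b_pow
  b_mul_a := by simpa using congrArg f h.b_mul_a
  c_mul_b := by simpa using congrArg f h.c_mul_b
  c_mul_c := by simpa using congrArg f h.c_mul_c
  c_mul_pow_mul_c k := by simpa using congrArg f (h.c_mul_pow_mul_c k)

lemma b_mul_pow (h : BruhatRelations a b c) (k : ℕ) : b * a ^ k = a ^ (4 * k) * b := by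
  have := h.b_mul_a
  have h1 : b * a * b⁻¹ = a ^ 4 := by rw [this, mul_inv_cancel_right]
  have h2 : b * a ^ k * b⁻¹ = a ^ (4 * k) := by rw [← conj_pow, h1, pow_mul]
  rw [← h2, inv_mul_cancel_right]

lemma pow_mul_pow (h : BruhatRelations a b c) (j k : ℕ) :
    b ^ j * a ^ k = a ^ (4 ^ j * k) * b ^ j := by
  induction j with
  | zero => simp
  | succ j ih => rw [pow_succ', mul_assoc, ih, ← mul_assoc, h.b_mul_pow, mul_assoc, pow_succ',
      mul_assoc]

lemma mul_pow_mul_pow (h : BruhatRelations a b c) (i j p q : ℕ) :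
    a ^ i * b ^ j * (a ^ p * b ^ q) = a ^ (i + 4 ^ j * p) * b ^ (j + q) := by
  rw [pow_add, pow_add, mul_assoc, ← mul_assoc (b ^ j), h.pow_mul_pow, mul_assoc, mul_assoc]

/-- The group `⟨a, b⟩` is the set of products `a^i b^j`. -/
lemma exists_of_mem_closure_pair (h : BruhatRelations a b c) {g : X}
    (hg : g ∈ Subgroup.closure {a, b}) : ∃ i j : ℕ, g = a ^ i * b ^ j := by
  have ha : a⁻¹ = a ^ 6 := inv_eq_of_mul_eq_one_right (by rw [← pow_succ', h.a_pow])
  have hb : b⁻¹ = b ^ 2 := inv_eq_of_mul_eq_one_right (by rw [← pow_succ', h.b_pow])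
  induction hg using Subgroup.closure_induction_right with
  | one => exact ⟨0, 0, by simp⟩
  | mul_right x hx y hy ih =>
    obtain ⟨i, j, rfl⟩ := ih
    rcases hy with rfl | rfl
    · exact ⟨_, _, by simpa using h.mul_pow_mul_pow i j 1 0⟩
    · exact ⟨_, _, by simpa using h.mul_pow_mul_pow i j 0 1⟩
  | mul_inv_cancel x hx y hy ih =>
    obtain ⟨i, j, rfl⟩ := ih
    rcases hy with rfl | rfl
    · rw [ha]
      exact ⟨_, _, by simpa using h.mul_pow_mul_pow i j 6 0⟩
    · rw [hb]
      exact ⟨_, _, by simpa using h.mul_pow_mul_pow i j 0 2⟩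

/-- The group `⟨a, b, c⟩` is the union of the subgroup `⟨a, b⟩ = 7:3` and the double coset
`⟨a, b⟩ c ⟨a⟩`. -/
lemma exists_of_mem_closure (h : BruhatRelations a b c) {g : X}
    (hg : g ∈ Subgroup.closure {a, b, c}) :
    (∃ i j : ℕ, g = a ^ i * b ^ j) ∨ ∃ i j k : ℕ, g = a ^ i * b ^ j * c * a ^ k := by
  set D : X → Prop := fun g =>
    (∃ i j : ℕ, g = a ^ i * b ^ j) ∨ ∃ i j k : ℕ, g = a ^ i * b ^ j * c * a ^ k with hD
  have mul_a : ∀ x, D x → D (x * a) := by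
    rintro x (⟨i, j, rfl⟩ | ⟨i, j, k, rfl⟩)
    · exact .inl ⟨_, _, by simpa using h.mul_pow_mul_pow i j 1 0⟩
    · exact .inr ⟨i, j, k + 1, by rw [pow_succ, ← mul_assoc]⟩
  have mul_b : ∀ x, D x → D (x * b) := by
    rintro x (⟨i, j, rfl⟩ | ⟨i, j, k, rfl⟩)
    · exact .inl ⟨i, j + 1, by rw [pow_succ, ← mul_assoc]⟩
    · -- `4` inverts `2` modulo `7`, so that `a ^ k * b = b * a ^ (2 * k)`
      have h1 : a ^ k * b = b * a ^ (2 * k) := by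
        rw [h.b_mul_pow, ← mul_assoc, show 4 * 2 * k = k + 7 * k by ring, pow_add, pow_mul, h.a_pow,
          one_pow, mul_one]
      refine .inr ⟨i + 4 ^ j * 4, j + 2, 4 + 2 * k, ?_⟩
      rw [← h.mul_pow_mul_pow, mul_assoc _ (a ^ k), h1, mul_assoc _ c, ← mul_assoc c, h.c_mul_b,
        pow_add a 4]
      simp only [mul_assoc]
  have mul_c : ∀ x, D x → D (x * c) := by
    rintro x (⟨i, j, rfl⟩ | ⟨i, j, k, rfl⟩)
    · exact .inr ⟨i, j, 0, by simp⟩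
    · rw [pow_eq_pow_mod k h.a_pow]
      obtain hk | ⟨l, hl⟩ : k % 7 = 0 ∨ ∃ l : Fin 6, k % 7 = (l + 1 : ℕ) := by
        rcases Nat.eq_zero_or_pos (k % 7) with h0 | h0
        · exact .inl h0
        · exact .inr ⟨⟨k % 7 - 1, by omega⟩, by simp; omega⟩
      · exact .inl ⟨i, j, by rw [hk, pow_zero, mul_one, mul_assoc, h.c_mul_c, mul_one]⟩
      · rw [hl, mul_assoc _ c, mul_assoc _ (c * _), h.c_mul_pow_mul_c, mul_assoc _ c, ← mul_assoc,
          h.mul_pow_mul_pow]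
        exact .inr ⟨_, _, _, by rw [mul_assoc _ c]⟩
  have ha : a⁻¹ = a ^ 6 := inv_eq_of_mul_eq_one_right (by rw [← pow_succ', h.a_pow])
  have hb : b⁻¹ = b ^ 2 := inv_eq_of_mul_eq_one_right (by rw [← pow_succ', h.b_pow])
  have hc : c⁻¹ = c := inv_eq_of_mul_eq_one_right h.c_mul_c
  change D g
  induction hg using Subgroup.closure_induction_right with
  | one => exact .inl ⟨0, 0, by simp⟩
  | mul_right x hx y hy ih =>
    rcases hy with rfl | rfl | rfl
    exacts [mul_a _ ih, mul_b _ ih, mul_c _ ih]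
  | mul_inv_cancel x hx y hy ih =>
    rcases hy with rfl | rfl | rfl
    · rw [ha]
      simp only [pow_succ, pow_zero, one_mul, ← mul_assoc]
      exact mul_a _ (mul_a _ (mul_a _ (mul_a _ (mul_a _ (mul_a _ ih)))))
    · rw [hb, pow_two, ← mul_assoc]
      exact mul_b _ (mul_b _ ih)
    · rw [hc]
      exact mul_c _ ih

end BruhatRelations

end Bruhat

namespace SignedPerm

lemma bruhatRelations_abc : BruhatRelations a b c := by
  constructor <;> decide +kernel

lemma bruhatRelations_abd : BruhatRelations a b d := by
  constructor <;> decide +kernel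

/-! ### The simple group of order 168 as a permutation group -/

/-- The group of permutations of the seven coordinates generated by `α̃, β̃, γ̃`. -/
def L : Subgroup (Equiv.Perm (Fin 7)) := Subgroup.closure {pa, pb, pc}

/-- The subgroup `7:3` of `L`. -/
def LF : Subgroup (Equiv.Perm (Fin 7)) := Subgroup.closure {pa, pb}

/-- The subgroup `⟨γ̃, θ̃⟩ ≅ S_4` of `L`. -/
def LS : Subgroup (Equiv.Perm (Fin 7)) := Subgroup.closure {pc, pt}

/-- The subgroup `⟨Ã, B̃⟩ ≅ S_4` of `L`. -/
def LT : Subgroup (Equiv.Perm (Fin 7)) := Subgroup.closure {pA, pB}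

lemma map_ofPerm_L : L.map ofPerm = P := by
  simp only [L, P, MonoidHom.map_closure, Set.image_insert_eq, Set.image_singleton]
  rfl

lemma map_ofPerm_LF : LF.map ofPerm = F := by
  simp only [LF, F, MonoidHom.map_closure, Set.image_insert_eq, Set.image_singleton]
  rfl

lemma map_ofPerm_LS : LS.map ofPerm = S := by
  simp only [LS, S, MonoidHom.map_closure, Set.image_insert_eq, Set.image_singleton]
  rfl

lemma map_ofPerm_LT : LT.map ofPerm = T := by
  simp only [LT, T, MonoidHom.map_closure, Set.image_insert_eq, Set.image_singleton]
  rfl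

lemma bruhatRelations_L : BruhatRelations pa pb pc := bruhatRelations_abc.map toPerm

lemma pa_mem : pa ∈ L := Subgroup.subset_closure (by simp)

lemma pb_mem : pb ∈ L := Subgroup.subset_closure (by simp)

lemma pc_mem : pc ∈ L := Subgroup.subset_closure (by simp)

lemma L_le {H : Subgroup (Equiv.Perm (Fin 7))} (ha : pa ∈ H) (hb : pb ∈ H) (hc : pc ∈ H) :
    L ≤ H := by
  refine (Subgroup.closure_le _).2 ?_
  rintro _ (rfl | rfl | rfl) <;> assumption

lemma LF_le : LF ≤ L := Subgroup.closure_mono (by simp [Set.insert_subset_iff])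

lemma LS_le : LS ≤ L := by
  refine (Subgroup.closure_le _).2 ?_
  rintro _ (rfl | rfl)
  · exact pc_mem
  · rw [show pt = pb * pc * pb * pc * pa by decide +kernel]
    exact mul_mem (mul_mem (mul_mem (mul_mem pb_mem pc_mem) pb_mem) pc_mem) pa_mem

lemma LT_le : LT ≤ L := by
  refine (Subgroup.closure_le _).2 ?_
  rintro _ (rfl | rfl)
  · rw [show pA = pa * pb * pa * pc * pb by decide +kernel]
    exact mul_mem (mul_mem (mul_mem (mul_mem pa_mem pb_mem) pa_mem) pc_mem) pb_mem
  · rw [show pB = pc * pa * pb * pc * pa * pb by decide +kernel]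
    exact mul_mem (mul_mem (mul_mem (mul_mem (mul_mem pc_mem pa_mem) pb_mem) pc_mem) pa_mem) pb_mem

/-- The list of the elements of `L` read off from its double coset decomposition. -/
def listL : (Fin 7 × Fin 3) ⊕ (Fin 7 × Fin 3 × Fin 7) → Equiv.Perm (Fin 7) :=
  Sum.elim (fun x => pa ^ (x.1 : ℕ) * pb ^ (x.2 : ℕ))
    fun x => pa ^ (x.1 : ℕ) * pb ^ (x.2.1 : ℕ) * pc * pa ^ (x.2.2 : ℕ)

lemma exists_listL_eq {g : Equiv.Perm (Fin 7)} (hg : g ∈ L) : ∃ x, listL x = g := by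
  have h := bruhatRelations_L
  rcases h.exists_of_mem_closure hg with ⟨i, j, rfl⟩ | ⟨i, j, k, rfl⟩
  · refine ⟨.inl (⟨i % 7, Nat.mod_lt _ (by simp)⟩, ⟨j % 3, Nat.mod_lt _ (by simp)⟩), ?_⟩
    simp [listL, ← pow_eq_pow_mod _ h.a_pow, ← pow_eq_pow_mod _ h.b_pow]
  · refine ⟨.inr (⟨i % 7, Nat.mod_lt _ (by simp)⟩, ⟨j % 3, Nat.mod_lt _ (by simp)⟩,
      ⟨k % 7, Nat.mod_lt _ (by simp)⟩), ?_⟩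
    simp [listL, ← pow_eq_pow_mod _ h.a_pow, ← pow_eq_pow_mod _ h.b_pow]

/-- The decomposition into `7:3`, of order 21, and a double coset of `21 * 7` elements. -/
lemma card_L_le : Nat.card L ≤ 168 := by
  have hs : Set.SurjOn listL Set.univ (L : Set (Equiv.Perm (Fin 7))) := fun g hg => by
    obtain ⟨x, hx⟩ := exists_listL_eq hg
    exact ⟨x, trivial, hx⟩
  have := Set.ncard_le_ncard hs (Set.toFinite _)
  have h2 := Set.ncard_image_le (f := listL) (Set.toFinite Set.univ)
  rw [Set.ncard_univ] at h2
  have h3 : Nat.card ((Fin 7 × Fin 3) ⊕ (Fin 7 × Fin 3 × Fin 7)) = 168 := by simp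
  exact (this.trans h2).trans h3.le

/-! ### The two classes of `S_4` -/

lemma closure_finRotate_swap (x : Fin 4) :
    Subgroup.closure {finRotate 4, Equiv.swap x (finRotate 4 x)} = ⊤ :=
  Equiv.Perm.closure_cycle_adjacent_swap (isCycle_finRotate_of_le (by simp))
    (support_finRotate_of_le (by simp)) x

/-- The coordinate standing for the partition `{i, j} ∪ {k, l}` of four points into two pairs, as a
function of `i ≠ j`. The value for `i = j` is immaterial. -/
def pairing : Fin 4 → Fin 4 → Fin 7 :=
  ![![0, 6, 2, 5], ![6, 0, 5, 2], ![2, 5, 0, 6], ![5, 2, 6, 0]]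

/-- The action of `S_4` on the seven coordinates with orbits of lengths 4 and 3: on the points
`0, 3, 1, 4` as on four points, and on `2, 5, 6` as on the pairings of these. -/
def homS : Equiv.Perm (Fin 4) →* Equiv.Perm (Fin 7) := MonoidHom.toHomPerm
  { toFun τ := ![(![0, 3, 1, 4] : Fin 4 → Fin 7) (τ 0), (![0, 3, 1, 4] : Fin 4 → Fin 7) (τ 2),
      pairing (τ 0) (τ 2), (![0, 3, 1, 4] : Fin 4 → Fin 7) (τ 1),
      (![0, 3, 1, 4] : Fin 4 → Fin 7) (τ 3), pairing (τ 0) (τ 3), pairing (τ 0) (τ 1)]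
    map_one' := funext (by decide +kernel)
    map_mul' x y := funext fun i => by revert x y i; decide +kernel }

/-- The coordinate standing for the two-element subset `{i, j}` of four points. The value for
`i = j` is immaterial. -/
def edge : Fin 4 → Fin 4 → Fin 7 :=
  ![![0, 0, 2, 1], ![0, 0, 4, 5], ![2, 4, 0, 3], ![1, 5, 3, 0]]

/-- The action of `S_4` on the seven coordinates with orbits of lengths 6 and 1: on the first six as
on the two-element subsets of four points. -/
def homT : Equiv.Perm (Fin 4) →* Equiv.Perm (Fin 7) := MonoidHom.toHomPerm
  { toFun τ := ![edge (τ 0) (τ 1), edge (τ 3) (τ 0), edge (τ 0) (τ 2), edge (τ 2) (τ 3),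
      edge (τ 1) (τ 2), edge (τ 1) (τ 3), 6]
    map_one' := funext (by decide +kernel)
    map_mul' x y := funext fun i => by revert x y i; decide +kernel }

lemma homS_injective : Function.Injective homS := by
  rw [injective_iff_map_eq_one]
  decide +kernel

lemma homT_injective : Function.Injective homT := by
  rw [injective_iff_map_eq_one]
  decide +kernel

lemma range_homS : homS.range = LS := by
  rw [MonoidHom.range_eq_map, ← closure_finRotate_swap 3, MonoidHom.map_closure,
    Set.image_pair, show homS (finRotate 4) = pt by decide +kernel,
    show homS (Equiv.swap 3 (finRotate 4 3)) = pc by decide +kernel, LS, Set.pair_comm]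

lemma range_homT : homT.range = LT := by
  rw [MonoidHom.range_eq_map, ← closure_finRotate_swap 1, MonoidHom.map_closure,
    Set.image_pair, show homT (finRotate 4) = pA * pB by decide +kernel,
    show homT (Equiv.swap 1 (finRotate 4 1)) = pB by decide +kernel]
  have hB : pB ∈ Subgroup.closure {pA * pB, pB} := Subgroup.subset_closure (by simp)
  have hAB : pA * pB ∈ Subgroup.closure {pA * pB, pB} := Subgroup.subset_closure (by simp)
  refine le_antisymm ((Subgroup.closure_le _).2 ?_) ((Subgroup.closure_le _).2 ?_)
  · have h1 : pA ∈ LT := Subgroup.subset_closure (by simp)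
    have h2 : pB ∈ LT := Subgroup.subset_closure (by simp)
    rintro _ (rfl | rfl)
    exacts [mul_mem h1 h2, h2]
  · rintro _ (rfl | rfl)
    · simpa using mul_mem hAB (inv_mem hB)
    · exact hB

/-- The isomorphism of `⟨γ̃, θ̃⟩` with `S_4`. -/
noncomputable def equivLS : LS ≃* Equiv.Perm (Fin 4) :=
  ((MonoidHom.ofInjective homS_injective).trans (MulEquiv.subgroupCongr range_homS)).symm

/-- The isomorphism of `⟨Ã, B̃⟩` with `S_4`. -/
noncomputable def equivLT : LT ≃* Equiv.Perm (Fin 4) :=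
  ((MonoidHom.ofInjective homT_injective).trans (MulEquiv.subgroupCongr range_homT)).symm

lemma card_perm_four : Nat.card (Equiv.Perm (Fin 4)) = 24 := by
  rw [Nat.card_perm, Nat.card_fin]
  rfl

lemma card_LS : Nat.card LS = 24 := (Nat.card_congr equivLS.toEquiv).trans card_perm_four

lemma card_LT : Nat.card LT = 24 := (Nat.card_congr equivLT.toEquiv).trans card_perm_four

lemma orderOf_pa : orderOf pa = 7 :=
  have : Fact (Nat.Prime 7) := ⟨by norm_num⟩
  orderOf_eq_prime (by decide +kernel) (by decide +kernel)

lemma orderOf_pb : orderOf pb = 3 := orderOf_eq_prime (by decide +kernel) (by decide +kernel)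

lemma card_L : Nat.card L = 168 := by
  have h1 : 24 ∣ Nat.card L := card_LS ▸ Subgroup.card_dvd_of_le LS_le
  have h2 : 7 ∣ Nat.card L := by
    have := Subgroup.card_dvd_of_le (Subgroup.zpowers_le.2 pa_mem)
    rwa [Nat.card_zpowers, orderOf_pa] at this
  have h3 : 24 * 7 ∣ Nat.card L := Nat.Coprime.mul_dvd_of_dvd_of_dvd (by norm_num) h1 h2
  exact le_antisymm card_L_le (Nat.le_of_dvd Nat.card_pos h3)

end SignedPerm

/-! ### Conjugates of subgroups -/

section Conjugates

variable {X : Type*} [Group X]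

lemma mem_map_conj {H : Subgroup X} {g x : X} :
    x ∈ H.map (MulAut.conj g).toMonoidHom ↔ g⁻¹ * x * g ∈ H := by
  constructor
  · rintro ⟨y, hy, rfl⟩
    simpa [mul_assoc] using hy
  · exact fun h => ⟨_, h, by simp [mul_assoc]⟩

lemma map_conj_map_conj (H : Subgroup X) (g h : X) :
    (H.map (MulAut.conj g).toMonoidHom).map (MulAut.conj h).toMonoidHom =
      H.map (MulAut.conj (h * g)).toMonoidHom := by
  ext x
  simp only [mem_map_conj, mul_inv_rev, mul_assoc]

lemma map_conj_of_mem {H : Subgroup X} {g : X} (hg : g ∈ H) :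
    H.map (MulAut.conj g).toMonoidHom = H := by
  ext x
  rw [mem_map_conj, mul_mem_cancel_right hg, mul_mem_cancel_left (inv_mem hg)]

lemma map_conj_le_map_conj_iff {H K : Subgroup X} {g : X} :
    H.map (MulAut.conj g).toMonoidHom ≤ K.map (MulAut.conj g).toMonoidHom ↔ H ≤ K :=
  Subgroup.map_le_map_iff_of_injective (MulAut.conj g).injective

lemma map_conj_lt {H K : Subgroup X} {g : X} (hg : g ∈ K) (h : H < K) :
    H.map (MulAut.conj g).toMonoidHom < K := by
  have h1 := map_conj_of_mem hg
  refine lt_iff_le_not_ge.2 ⟨?_, fun h' => h.not_ge ?_⟩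
  · rw [← h1]
    exact map_conj_le_map_conj_iff.2 h.le
  · rwa [← map_conj_le_map_conj_iff (g := g), h1]

lemma card_map_conj (H : Subgroup X) (g : X) :
    Nat.card (H.map (MulAut.conj g).toMonoidHom) = Nat.card H :=
  Subgroup.card_map_of_injective (MulAut.conj g).injective

/-- A consequence of Sylow's theorem: if the prime `p` divides `|L|` exactly once, then a subgroup
of `L` containing an element of order `p` has a conjugate in `L` containing any given one. -/
lemma exists_mem_map_conj_of_orderOf_eq [Finite X] {L H : Subgroup X} (hH : H ≤ L) {p : ℕ}
    [Fact p.Prime] (hp : (Nat.card L).factorization p = 1) {x y : X} (hx : x ∈ H) (hy : y ∈ L)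
    (hxp : orderOf x = p) (hyp : orderOf y = p) :
    ∃ g ∈ L, y ∈ H.map (MulAut.conj g).toMonoidHom := by
  let x' : L := ⟨x, hH hx⟩
  let y' : L := ⟨y, hy⟩
  have hx' : Nat.card (Subgroup.zpowers x') = p ^ (Nat.card L).factorization p := by
    rw [hp, pow_one, Nat.card_zpowers, ← hxp]
    exact Subgroup.orderOf_mk _ _
  have hy' : Nat.card (Subgroup.zpowers y') = p ^ (Nat.card L).factorization p := by
    rw [hp, pow_one, Nat.card_zpowers, ← hyp]
    exact Subgroup.orderOf_mk _ _
  obtain ⟨g, hg⟩ := MulAction.exists_smul_eq L (Sylow.ofCard _ hx') (Sylow.ofCard _ hy')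
  refine ⟨g, g.2, mem_map_conj.2 ?_⟩
  have h1 : y' ∈ (Sylow.ofCard _ hy' : Sylow p L) := Subgroup.mem_zpowers y'
  rw [← hg, ← SetLike.mem_coe, Sylow.coe_smul, Set.mem_smul_set_iff_inv_smul_mem] at h1
  obtain ⟨k, hk⟩ : (MulAut.conj g)⁻¹ • y' ∈ Subgroup.zpowers x' := h1
  have h2 : (x : X) ^ k = (g : X)⁻¹ * y * g := by simpa using congrArg (Subtype.val) hk
  rw [← h2]
  exact zpow_mem hx k

/-- A group is not the union of two proper subgroups. -/
lemma le_or_le_of_subset_union {H A B : Subgroup X} (h : ∀ x ∈ H, x ∈ A ∨ x ∈ B) :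
    H ≤ A ∨ H ≤ B := by
  by_contra! hc
  obtain ⟨⟨x, hx, hxA⟩, ⟨y, hy, hyB⟩⟩ :=
    And.intro (SetLike.not_le_iff_exists.1 hc.1) (SetLike.not_le_iff_exists.1 hc.2)
  have hxB := (h x hx).resolve_left hxA
  have hyA := (h y hy).resolve_right hyB
  rcases h _ (mul_mem hx hy) with h1 | h1
  · exact hxA ((mul_mem_cancel_right hyA).1 h1)
  · exact hyB ((mul_mem_cancel_left hxB).1 h1)

end Conjugates

namespace SignedPerm

/-! ### Subgroups of the simple group of order 168 -/

/-- The subgroup `7:3` is the largest proper subgroup of `L` containing `α̃`: together with `α̃`, any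
element of the double coset outside `7:3` yields some `β̃^j γ̃`, and these generate `L`. -/
lemma le_LF_or_eq_L {H : Subgroup (Equiv.Perm (Fin 7))} (hH : H ≤ L) (ha : pa ∈ H) :
    H ≤ LF ∨ H = L := by
  refine or_iff_not_imp_left.2 fun hF => le_antisymm hH ?_
  obtain ⟨g, hg, hgF⟩ := SetLike.not_le_iff_exists.1 hF
  obtain ⟨j, hj⟩ : ∃ j : Fin 3, pb ^ (j : ℕ) * pc ∈ H := by
    rcases bruhatRelations_L.exists_of_mem_closure (hH hg) with ⟨i, j, rfl⟩ | ⟨i, j, k, rfl⟩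
    · exact absurd (mul_mem (pow_mem (Subgroup.subset_closure (by simp)) i)
        (pow_mem (Subgroup.subset_closure (by simp)) j)) hgF
    · refine ⟨⟨j % 3, Nat.mod_lt _ (by simp)⟩, ?_⟩
      rw [mul_mem_cancel_right (pow_mem ha k), mul_assoc, mul_mem_cancel_left (pow_mem ha i)] at hg
      rwa [← pow_eq_pow_mod _ bruhatRelations_L.b_pow]
  -- explicit words for `β̃` in `α̃` and `β̃^j γ̃`, one for each `j`
  have hb : pb ∈ H := by
    have key : ∀ j : Fin 3,
        pb = pa ^ 3 * (pb ^ (j : ℕ) * pc) * pa ^ 2 * (pb ^ (j : ℕ) * pc) * pa *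
          (pb ^ (j : ℕ) * pc) ∨
        pb = pa ^ 2 * (pb ^ (j : ℕ) * pc) * pa ^ 2 * (pb ^ (j : ℕ) * pc) ^ 2 ∨
        pb = (pb ^ (j : ℕ) * pc) * pa ^ 2 * (pb ^ (j : ℕ) * pc) * pa *
          (pb ^ (j : ℕ) * pc) ^ 2 := by decide +kernel
    rcases key j with h | h | h
    · rw [h]
      exact mul_mem (mul_mem (mul_mem (mul_mem (mul_mem (pow_mem ha 3) hj) (pow_mem ha 2)) hj) ha)
        hj
    · rw [h]
      exact mul_mem (mul_mem (mul_mem (pow_mem ha 2) hj) (pow_mem ha 2)) (pow_mem hj 2)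
    · rw [h]
      exact mul_mem (mul_mem (mul_mem (mul_mem hj (pow_mem ha 2)) hj) ha) (pow_mem hj 2)
  exact L_le ha hb ((mul_mem_cancel_left (pow_mem hb _)).1 hj)

/-- A subgroup of order 24 has index 7 in `L`, a prime. -/
lemma eq_or_eq_of_card_eq {A H : Subgroup (Equiv.Perm (Fin 7))} (hA : Nat.card A = 24)
    (hAH : A ≤ H) (hH : H ≤ L) : H = A ∨ H = L := by
  have h1 : 24 ∣ Nat.card H := hA ▸ Subgroup.card_dvd_of_le hAH
  have h2 : Nat.card H ∣ 168 := card_L ▸ Subgroup.card_dvd_of_le hH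
  obtain ⟨k, hk⟩ := h1
  rw [hk, show 168 = 24 * 7 by norm_num, Nat.mul_dvd_mul_iff_left (by norm_num)] at h2
  rcases (Nat.dvd_prime (by norm_num)).1 h2 with rfl | rfl
  · exact .inl (Subgroup.eq_of_le_of_card_ge hAH (by rw [hk, hA])).symm
  · exact .inr (Subgroup.eq_of_le_of_card_ge hH (by rw [hk, card_L]))

/-- The subgroup of permutations fixing the last coordinate. -/
def stabLast : Subgroup (Equiv.Perm (Fin 7)) := MulAction.stabilizer _ (6 : Fin 7)

lemma mem_stabLast {σ : Equiv.Perm (Fin 7)} : σ ∈ stabLast ↔ σ 6 = 6 := Iff.rfl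

/-- The subgroup of permutations centralizing a given signed permutation. -/
def permCentralizer (x : SignedPerm) : Subgroup (Equiv.Perm (Fin 7)) :=
  (Subgroup.centralizer {x}).comap ofPerm

lemma mem_permCentralizer {x : SignedPerm} {σ : Equiv.Perm (Fin 7)} :
    σ ∈ permCentralizer x ↔ x * ofPerm σ = ofPerm σ * x := by
  rw [permCentralizer, Subgroup.mem_comap, Subgroup.mem_centralizer_singleton_iff, eq_comm]

instance (x : SignedPerm) (σ : Equiv.Perm (Fin 7)) : Decidable (σ ∈ permCentralizer x) :=
  decidable_of_iff _ mem_permCentralizer.symm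

lemma LT_le_stabLast : LT ≤ stabLast := by
  refine (Subgroup.closure_le _).2 ?_
  rintro _ (rfl | rfl) <;> exact mem_stabLast.2 (by decide +kernel)

lemma LS_le_permCentralizer : LS ≤ permCentralizer n6 := by
  refine (Subgroup.closure_le _).2 ?_
  have h1 : pc ∈ permCentralizer n6 := by decide +kernel
  have h2 : pt ∈ permCentralizer n6 := by decide +kernel
  rintro _ (rfl | rfl) <;> assumption

/-- `⟨Ã, B̃⟩` is the stabilizer in `L` of the last coordinate. -/
lemma L_inf_stabLast : L ⊓ stabLast = LT := by
  refine (eq_or_eq_of_card_eq card_LT (le_inf LT_le LT_le_stabLast) inf_le_left).resolve_right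
    fun h => ?_
  have : pa 6 = 6 := mem_stabLast.1 (inf_eq_left.1 h pa_mem)
  revert this
  decide +kernel

/-- `⟨γ̃, θ̃⟩` is the stabilizer in `L` of `N_6`. -/
lemma L_inf_permCentralizer : L ⊓ permCentralizer n6 = LS := by
  refine (eq_or_eq_of_card_eq card_LS (le_inf LS_le LS_le_permCentralizer)
    inf_le_left).resolve_right fun h => ?_
  have h1 : pa ∈ permCentralizer n6 := inf_eq_left.1 h pa_mem
  revert h1
  decide +kernel

/-- The property that a subgroup has a conjugate in `L` contained in one of `7:3` and the two
`S_4`. -/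
def IsConjSmall (H : Subgroup (Equiv.Perm (Fin 7))) : Prop :=
  ∃ g ∈ L, H.map (MulAut.conj g).toMonoidHom ≤ LF ∨ H.map (MulAut.conj g).toMonoidHom ≤ LS ∨
    H.map (MulAut.conj g).toMonoidHom ≤ LT

lemma IsConjSmall.of_map_conj {H : Subgroup (Equiv.Perm (Fin 7))} {g : Equiv.Perm (Fin 7)}
    (hg : g ∈ L) (h : IsConjSmall (H.map (MulAut.conj g).toMonoidHom)) : IsConjSmall H := by
  obtain ⟨g', hg', h⟩ := h
  simp only [map_conj_map_conj] at h
  exact ⟨_, mul_mem hg' hg, h⟩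

lemma map_conj_le_L {H : Subgroup (Equiv.Perm (Fin 7))} (hH : H ≤ L) {g : Equiv.Perm (Fin 7)}
    (hg : g ∈ L) : H.map (MulAut.conj g).toMonoidHom ≤ L := by
  rw [← map_conj_of_mem hg]
  exact map_conj_le_map_conj_iff.2 hH

/-- The group `L` is transitive on the coordinates. -/
lemma isConjSmall_of_fixes {H : Subgroup (Equiv.Perm (Fin 7))} (hH : H ≤ L) (i : Fin 7)
    (hi : ∀ σ ∈ H, σ i = i) : IsConjSmall H := by
  have key : ∀ i : Fin 7, ∃ k : Fin 7, (pa ^ (k : ℕ)) i = 6 := by decide +kernel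
  obtain ⟨k, hk⟩ := key i
  have hg : pa ^ (k : ℕ) ∈ L := pow_mem pa_mem _
  refine ⟨_, hg, .inr (.inr ?_)⟩
  rw [← L_inf_stabLast]
  refine le_inf (map_conj_le_L hH hg) ?_
  rintro _ ⟨σ, hσ, rfl⟩
  have : (pa ^ (k : ℕ))⁻¹ 6 = i := by rw [← hk]; simp
  rw [mem_stabLast]
  simp only [MulEquiv.toMonoidHom_eq_coe, MonoidHom.coe_coe, MulAut.conj_apply,
    Equiv.Perm.mul_apply, this, hi σ hσ, hk]

/-- The group `L` is transitive on the involutions of `E`. -/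
lemma isConjSmall_of_le_permCentralizer {H : Subgroup (Equiv.Perm (Fin 7))} (hH : H ≤ L)
    (h : H ≤ permCentralizer n1) : IsConjSmall H := by
  obtain ⟨k, hk⟩ := exists_pow_conj_eq n1_mem_E n1_ne_one n6_mem_E (by decide +kernel)
  have hg : pa ^ (k : ℕ) ∈ L := pow_mem pa_mem _
  refine ⟨_, hg, .inr (.inl ?_)⟩
  rw [← L_inf_permCentralizer]
  refine le_inf (map_conj_le_L hH hg) ?_
  rintro _ ⟨σ, hσ, rfl⟩
  have h1 := mem_permCentralizer.1 (h hσ)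
  rw [mem_permCentralizer, ← hk]
  have h2 : ofPerm ((MulAut.conj (pa ^ (k : ℕ))).toMonoidHom σ) =
      a ^ (k : ℕ) * ofPerm σ * (a ^ (k : ℕ))⁻¹ := by
    change ofPerm (pa ^ (k : ℕ) * σ * (pa ^ (k : ℕ))⁻¹) = _
    rw [map_mul, map_mul, map_inv, map_pow]
    rfl
  rw [h2]
  calc _ = a ^ (k : ℕ) * (n1 * ofPerm σ) * (a ^ (k : ℕ))⁻¹ := by group
    _ = a ^ (k : ℕ) * (ofPerm σ * n1) * (a ^ (k : ℕ))⁻¹ := by rw [h1]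
    _ = _ := by group

/-- The permutation `g` fixes the last coordinate, fixes `N_1`, or has one of the elements
`g, β̃g, β̃²g, gβ̃g⁻¹β̃⁻¹` of order 7. -/
def FixesOrHasSeven (g : Equiv.Perm (Fin 7)) : Prop :=
  g 6 = 6 ∨ g ∈ permCentralizer n1 ∨ (g ^ 7 = 1 ∧ g ≠ 1) ∨ ((pb * g) ^ 7 = 1 ∧ pb * g ≠ 1) ∨
    ((pb ^ 2 * g) ^ 7 = 1 ∧ pb ^ 2 * g ≠ 1) ∨
    ((g * pb * g⁻¹ * pb⁻¹) ^ 7 = 1 ∧ g * pb * g⁻¹ * pb⁻¹ ≠ 1)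

instance (g : Equiv.Perm (Fin 7)) : Decidable (FixesOrHasSeven g) := by
  unfold FixesOrHasSeven
  infer_instance

lemma fixesOrHasSeven {g : Equiv.Perm (Fin 7)} (hg : g ∈ L) : FixesOrHasSeven g := by
  have h1 : ∀ (i : Fin 7) (j : Fin 3), FixesOrHasSeven (pa ^ (i : ℕ) * pb ^ (j : ℕ)) := by
    decide +kernel
  have h2 : ∀ (i : Fin 7) (j : Fin 3) (k : Fin 7),
      FixesOrHasSeven (pa ^ (i : ℕ) * pb ^ (j : ℕ) * pc * pa ^ (k : ℕ)) := by
    decide +kernel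
  obtain ⟨⟨i, j⟩ | ⟨i, j, k⟩, rfl⟩ := exists_listL_eq hg
  exacts [h1 i j, h2 i j k]

/-- A subgroup of `L` containing `β̃`, of order not divisible by 7, fixes the last coordinate or
`N_1`: each of its elements does, and a group is not the union of two proper subgroups. -/
lemma isConjSmall_of_pb_mem {H : Subgroup (Equiv.Perm (Fin 7))} (hH : H ≤ L) (hb : pb ∈ H)
    (h7 : ¬ 7 ∣ Nat.card H) : IsConjSmall H := by
  have not7 : ∀ x ∈ H, ¬ (x ^ 7 = 1 ∧ x ≠ 1) := by
    rintro x hx ⟨h1, h2⟩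
    have : Fact (Nat.Prime 7) := ⟨by norm_num⟩
    have h3 := Subgroup.orderOf_dvd_natCard H hx
    rw [orderOf_eq_prime h1 h2] at h3
    exact h7 h3
  have key : ∀ x ∈ H, x ∈ stabLast ∨ x ∈ permCentralizer n1 := by
    intro x hx
    rcases fixesOrHasSeven (hH hx) with h | h | h | h | h | h
    · exact .inl h
    · exact .inr h
    · exact absurd h (not7 _ hx)
    · exact absurd h (not7 _ (mul_mem hb hx))
    · exact absurd h (not7 _ (mul_mem (pow_mem hb 2) hx))
    · exact absurd h (not7 _ (mul_mem (mul_mem (mul_mem hx hb) (inv_mem hx)) (inv_mem hb)))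
  rcases le_or_le_of_subset_union key with h | h
  · exact isConjSmall_of_fixes hH 6 fun σ hσ => mem_stabLast.1 (h hσ)
  · exact isConjSmall_of_le_permCentralizer hH h

/-- Every proper subgroup of `PSL_2(7)` is contained in a conjugate of `7:3` or of one of the two
`S_4`. -/
theorem isConjSmall_of_ne {H : Subgroup (Equiv.Perm (Fin 7))} (hH : H ≤ L) (hne : H ≠ L) :
    IsConjSmall H := by
  have f168 : (168 : ℕ) = 2 ^ 3 * 3 * 7 := by norm_num
  have hf7 : (Nat.card L).factorization 7 = 1 := by
    rw [card_L]
    simp [Nat.factorization_eq_primeFactorsList_multiset, f168]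
  have hf3 : (Nat.card L).factorization 3 = 1 := by
    rw [card_L]
    simp [Nat.factorization_eq_primeFactorsList_multiset, f168]
  by_cases h7 : 7 ∣ Nat.card H
  · have : Fact (Nat.Prime 7) := ⟨by norm_num⟩
    obtain ⟨x, hx⟩ := exists_prime_orderOf_dvd_card' 7 h7
    obtain ⟨g, hg, ha⟩ := exists_mem_map_conj_of_orderOf_eq hH hf7 x.2 pa_mem
      (by rw [Subgroup.orderOf_coe, hx]) orderOf_pa
    rcases le_LF_or_eq_L (map_conj_le_L hH hg) ha with h | h
    · exact ⟨g, hg, .inl h⟩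
    · rw [← map_conj_of_mem hg] at h
      exact absurd (Subgroup.map_injective (MulAut.conj g).injective h) hne
  by_cases h3 : 3 ∣ Nat.card H
  · obtain ⟨x, hx⟩ := exists_prime_orderOf_dvd_card' 3 h3
    obtain ⟨g, hg, hb⟩ := exists_mem_map_conj_of_orderOf_eq hH hf3 x.2 pb_mem
      (by rw [Subgroup.orderOf_coe, hx]) orderOf_pb
    exact (isConjSmall_of_pb_mem (map_conj_le_L hH hg) hb (by rwa [card_map_conj])).of_map_conj hg
  · -- a 2-group fixes one of an odd number of points
    have h8 : Nat.card H ∣ 2 ^ 3 := by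
      have h1 : Nat.card H ∣ 2 ^ 3 * 3 * 7 := by
        rw [← f168, ← card_L]
        exact Subgroup.card_dvd_of_le hH
      have h2 := Nat.Coprime.dvd_of_dvd_mul_right
        ((Nat.Prime.coprime_iff_not_dvd (by norm_num)).2 h7).symm h1
      exact Nat.Coprime.dvd_of_dvd_mul_right
        ((Nat.Prime.coprime_iff_not_dvd (by norm_num)).2 h3).symm h2
    obtain ⟨n, -, hn⟩ := (Nat.dvd_prime_pow Nat.prime_two).1 h8
    obtain ⟨i, hi⟩ := (IsPGroup.of_card hn).nonempty_fixed_point_of_prime_not_dvd_card (Fin 7)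
      (by simp)
    exact isConjSmall_of_fixes hH i fun σ hσ => hi ⟨σ, hσ⟩

/-! ### Subgroups containing the sign changes -/

lemma ofPerm_injective : Function.Injective ofPerm := SemidirectProduct.inr_injective

lemma toPerm_ofPerm (σ : Equiv.Perm (Fin 7)) : toPerm (ofPerm σ) = σ :=
  SemidirectProduct.rightHom_inr σ

/-- The preimage in `G` of a subgroup `A` of `L`. -/
def lift (A : Subgroup (Equiv.Perm (Fin 7))) : Subgroup SignedPerm := E ⊔ A.map ofPerm

lemma map_ofPerm_le_G {A : Subgroup (Equiv.Perm (Fin 7))} (hA : A ≤ L) : A.map ofPerm ≤ G :=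
  (Subgroup.map_mono hA).trans (map_ofPerm_L.le.trans P_le_G)

lemma mem_lift_iff {A : Subgroup (Equiv.Perm (Fin 7))} (hA : A ≤ L) {x : SignedPerm} :
    x ∈ lift A ↔ x ∈ G ∧ toPerm x ∈ A := by
  constructor
  · intro hx
    refine ⟨sup_le E_le_G (map_ofPerm_le_G hA) hx, ?_⟩
    have : lift A ≤ A.comap toPerm := by
      refine sup_le (fun y hy => ?_) (Subgroup.map_le_iff_le_comap.2 fun σ hσ => ?_)
      · rw [Subgroup.mem_comap, E_le_ker hy]
        exact one_mem A
      · rw [Subgroup.mem_comap, Subgroup.mem_comap, toPerm_ofPerm]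
        exact hσ
    exact this hx
  · rintro ⟨hx, hxA⟩
    rw [← E_sup_P, mem_sup_of_le_normalizer (P_le_G.trans G_le_normalizer_E)] at hx
    obtain ⟨e, he, p, hp, rfl⟩ := hx
    obtain ⟨σ, rfl⟩ := P_le_range_ofPerm hp
    rw [map_mul, E_le_ker he, one_mul, toPerm_ofPerm] at hxA
    exact mul_mem (Subgroup.mem_sup_left he) (Subgroup.mem_sup_right ⟨σ, hxA, rfl⟩)

lemma lift_L : lift L = G := by rw [lift, map_ofPerm_L, E_sup_P]

lemma toPerm_mem_L {x : SignedPerm} (hx : x ∈ G) : toPerm x ∈ L := by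
  rw [← lift_L] at hx
  exact ((mem_lift_iff le_rfl).1 hx).2

lemma map_toPerm_le_L {H : Subgroup SignedPerm} (hH : H ≤ G) : H.map toPerm ≤ L := by
  rintro _ ⟨x, hx, rfl⟩
  exact toPerm_mem_L (hH hx)

lemma mem_E_of_toPerm_eq_one {x : SignedPerm} (hx : x ∈ G) (h : toPerm x = 1) : x ∈ E := by
  have := (mem_lift_iff (A := ⊥) bot_le).2 ⟨hx, Subgroup.mem_bot.2 h⟩
  simpa [lift] using this

lemma lift_map_toPerm {H : Subgroup SignedPerm} (hE : E ≤ H) (hH : H ≤ G) :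
    lift (H.map toPerm) = H := by
  ext x
  rw [mem_lift_iff (map_toPerm_le_L hH)]
  refine ⟨?_, fun hx => ⟨hH hx, x, hx, rfl⟩⟩
  rintro ⟨hx, y, hy, hxy⟩
  have h1 : x * y⁻¹ ∈ E := mem_E_of_toPerm_eq_one (mul_mem hx (inv_mem (hH hy)))
    (by rw [map_mul, map_inv, hxy, mul_inv_cancel])
  simpa using mul_mem (hE h1) hy

lemma lift_mono {A B : Subgroup (Equiv.Perm (Fin 7))} (h : A ≤ B) : lift A ≤ lift B :=
  sup_le_sup_left (Subgroup.map_mono h) _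

lemma map_toPerm_lift (A : Subgroup (Equiv.Perm (Fin 7))) : (lift A).map toPerm = A := by
  rw [lift, Subgroup.map_sup, (Subgroup.map_eq_bot_iff _).2 E_le_ker, bot_sup_eq, Subgroup.map_map]
  simp

/-- Maximal subgroups of `L` lift to maximal subgroups of `G`. -/
lemma lift_covBy {A : Subgroup (Equiv.Perm (Fin 7))} (hA : A ≤ L) (hne : A ≠ L)
    (h : ∀ H, A ≤ H → H ≤ L → H = A ∨ H = L) : lift A ⋖ G := by
  rw [← lift_L]
  refine covBy_of_eq_or_eq (lt_of_le_of_ne (lift_mono hA) fun he => hne ?_) fun H h1 h2 => ?_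
  · rw [← map_toPerm_lift A, he, map_toPerm_lift]
  · have hHG : H ≤ G := h2.trans lift_L.le
    have h3 : A ≤ H.map toPerm := map_toPerm_lift A ▸ Subgroup.map_mono h1
    rw [← lift_map_toPerm (le_sup_left.trans h1) hHG]
    exact (h _ h3 (map_toPerm_le_L hHG)).imp (congrArg lift) (congrArg lift)

lemma M1_eq_lift : M1 = lift LF := by
  have ha : a ∈ M1 := Subgroup.subset_closure (by simp)
  have hb : b ∈ M1 := Subgroup.subset_closure (by simp)
  have h1 : n1 ∈ M1 := Subgroup.subset_closure (by simp)
  rw [lift, map_ofPerm_LF]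
  refine le_antisymm ((Subgroup.closure_le _).2 ?_)
    (sup_le (E_le_of_a_mem ha h1) ((Subgroup.closure_le _).2 ?_))
  · rintro _ (rfl | rfl | rfl)
    exacts [Subgroup.mem_sup_right (Subgroup.subset_closure (by simp)),
      Subgroup.mem_sup_right (Subgroup.subset_closure (by simp)), Subgroup.mem_sup_left n1_mem_E]
  · rintro _ (rfl | rfl) <;> assumption

lemma M2_eq_lift : M2 = lift LS := by
  have hc : c ∈ M2 := Subgroup.subset_closure (by simp)
  have ht : t ∈ M2 := Subgroup.subset_closure (by simp)
  have h1 : n1 ∈ M2 := Subgroup.subset_closure (by simp)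
  rw [lift, map_ofPerm_LS]
  refine le_antisymm ((Subgroup.closure_le _).2 ?_)
    (sup_le ((Subgroup.closure_le _).2 ?_) ((Subgroup.closure_le _).2 ?_))
  · rintro _ (rfl | rfl | rfl)
    exacts [Subgroup.mem_sup_right (Subgroup.subset_closure (by simp)),
      Subgroup.mem_sup_right (Subgroup.subset_closure (by simp)), Subgroup.mem_sup_left n1_mem_E]
  · rintro _ (rfl | rfl | rfl)
    · exact h1
    · rw [show n2 = c * t ^ 3 * n1 * t * c by decide +kernel]
      exact mul_mem (mul_mem (mul_mem (mul_mem hc (pow_mem ht 3)) h1) ht) hc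
    · rw [show n7 = c * n1 * c * n1 by decide +kernel]
      exact mul_mem (mul_mem (mul_mem hc h1) hc) h1
  · rintro _ (rfl | rfl) <;> assumption

lemma M3_eq_lift : M3 = lift LT := by
  have hA : A ∈ M3 := Subgroup.subset_closure (by simp)
  have hB : B ∈ M3 := Subgroup.subset_closure (by simp)
  have h1 : n1 ∈ M3 := Subgroup.subset_closure (by simp)
  rw [lift, map_ofPerm_LT]
  refine le_antisymm ((Subgroup.closure_le _).2 ?_)
    (sup_le ((Subgroup.closure_le _).2 ?_) ((Subgroup.closure_le _).2 ?_))
  · rintro _ (rfl | rfl | rfl)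
    exacts [Subgroup.mem_sup_right (Subgroup.subset_closure (by simp)),
      Subgroup.mem_sup_right (Subgroup.subset_closure (by simp)), Subgroup.mem_sup_left n1_mem_E]
  · rintro _ (rfl | rfl | rfl)
    · exact h1
    · rw [show n2 = A * n1 * A ^ 2 * n1 by decide +kernel]
      exact mul_mem (mul_mem (mul_mem hA h1) (pow_mem hA 2)) h1
    · rw [show n7 = A ^ 2 * n1 * A by decide +kernel]
      exact mul_mem (mul_mem (pow_mem hA 2) h1) hA
  · rintro _ (rfl | rfl) <;> assumption

lemma pc_notMem_LF : pc ∉ LF := by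
  intro h
  obtain ⟨i, j, hij⟩ := bruhatRelations_L.exists_of_mem_closure_pair h
  have h7 := bruhatRelations_L.a_pow
  have h3 := bruhatRelations_L.b_pow
  rw [pow_eq_pow_mod i h7, pow_eq_pow_mod j h3] at hij
  have key : ∀ (i : Fin 7) (j : Fin 3), pc ≠ pa ^ (i : ℕ) * pb ^ (j : ℕ) := by decide +kernel
  exact key ⟨i % 7, Nat.mod_lt _ (by simp)⟩ ⟨j % 3, Nat.mod_lt _ (by simp)⟩ hij

lemma M1_covBy : M1 ⋖ G := by
  rw [M1_eq_lift]
  refine lift_covBy LF_le (fun h => pc_notMem_LF (h ▸ pc_mem)) fun H h1 h2 => ?_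
  exact (le_LF_or_eq_L h2 (h1 (Subgroup.subset_closure (by simp)))).imp_left
    fun h => le_antisymm h h1

lemma M2_covBy : M2 ⋖ G := by
  rw [M2_eq_lift]
  refine lift_covBy LS_le (fun h => ?_) fun H h1 h2 => eq_or_eq_of_card_eq card_LS h1 h2
  have := card_LS
  rw [h, card_L] at this
  omega

lemma M3_covBy : M3 ⋖ G := by
  rw [M3_eq_lift]
  refine lift_covBy LT_le (fun h => ?_) fun H h1 h2 => eq_or_eq_of_card_eq card_LT h1 h2
  have := card_LT
  rw [h, card_L] at this
  omega

/-! ### Complements of the sign changes -/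

lemma n6_mul_d : n6 * d = c := by decide +kernel

lemma a_mem_Q : a ∈ Q := Subgroup.subset_closure (by simp)

lemma b_mem_Q : b ∈ Q := Subgroup.subset_closure (by simp)

lemma d_mem_Q : d ∈ Q := Subgroup.subset_closure (by simp)

lemma d_mem_G : d ∈ G := by
  rw [show d = n6 * c by decide +kernel]
  exact mul_mem (E_le_G n6_mem_E) (P_le_G c_mem_P)

lemma Q_le_G : Q ≤ G := by
  refine (Subgroup.closure_le _).2 ?_
  rintro _ (rfl | rfl | rfl)
  exacts [P_le_G a_mem_P, P_le_G b_mem_P, d_mem_G]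

lemma E_sup_Q : E ⊔ Q = G := by
  have ha : a ∈ E ⊔ Q := Subgroup.mem_sup_right a_mem_Q
  have hb : b ∈ E ⊔ Q := Subgroup.mem_sup_right b_mem_Q
  refine le_antisymm (sup_le E_le_G Q_le_G) ((Subgroup.closure_le _).2 ?_)
  rintro _ (rfl | rfl | rfl | rfl)
  · exact ha
  · exact hb
  · rw [← n6_mul_d]
    exact mul_mem (Subgroup.mem_sup_left n6_mem_E) (Subgroup.mem_sup_right d_mem_Q)
  · exact Subgroup.mem_sup_left n1_mem_E

/-- Since `δ` satisfies the same relations as `γ̃`, an element of `⟨α̃, β̃, δ⟩` is `α̃^i β̃^j` or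
`α̃^i β̃^j δ α̃^k`; in the second case its permutation is not trivial. -/
lemma E_inf_Q : E ⊓ Q = ⊥ := by
  rw [eq_bot_iff]
  rintro x ⟨hxE, hxQ⟩
  have hx : toPerm x = 1 := E_le_ker hxE
  rcases bruhatRelations_abd.exists_of_mem_closure hxQ with ⟨i, j, rfl⟩ | ⟨i, j, k, rfl⟩
  · rw [← E_inf_P]
    exact ⟨hxE, mul_mem (pow_mem a_mem_P _) (pow_mem b_mem_P _)⟩
  · have h1 : pa ^ i * pb ^ j * pc * pa ^ k = 1 := by
      have : toPerm (a ^ i * b ^ j * d * a ^ k) = pa ^ i * pb ^ j * pc * pa ^ k := by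
        simp only [map_mul, map_pow]
        rfl
      rw [← this, hx]
    have ha : pa ∈ LF := Subgroup.subset_closure (by simp)
    have hb : pb ∈ LF := Subgroup.subset_closure (by simp)
    have h2 := one_mem LF
    rw [← h1, mul_mem_cancel_right (pow_mem ha k),
      mul_mem_cancel_left (mul_mem (pow_mem ha i) (pow_mem hb j))] at h2
    exact absurd h2 pc_notMem_LF

lemma isSplitExtension_Q : IsSplitExtension G E Q :=
  isSplitExtension_of_le_normalizer (Q_le_G.trans G_le_normalizer_E) E_inf_Q E_sup_Q

/-- Any subgroup that covers `G / E` acts on `E` as `G` does; hence it contains `E` as soon as it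
meets `E`, because `E` is irreducible under `α̃`. -/
lemma E_le_of_inf_ne_bot {H : Subgroup SignedPerm} (hH : H ≤ G) (hsup : E ⊔ H = G)
    (hne : E ⊓ H ≠ ⊥) : E ≤ H := by
  obtain ⟨x, ⟨hxE, hxH⟩, hx1⟩ := (Subgroup.ne_bot_iff_exists_ne_one).1 hne |>.imp
    fun x hx => And.intro x.2 fun h => hx (Subtype.ext h)
  refine E_le_of_conj_mem hxE hx1 hxH fun y hy hyH => ?_
  have ha : a ∈ E ⊔ H := hsup ▸ P_le_G a_mem_P
  obtain ⟨e, he, h, hh, hea⟩ := (mem_sup_of_le_normalizer (hH.trans G_le_normalizer_E)).1 ha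
  have hcomm : ∀ x ∈ E, ∀ y ∈ E, x * y = y * x := by
    intro x hx y hy
    obtain ⟨v, rfl⟩ := mem_E_iff.1 hx
    obtain ⟨w, rfl⟩ := mem_E_iff.1 hy
    rw [← map_mul, mul_comm, map_mul]
  have h1 : h * y * h⁻¹ ∈ E := conj_mem_E (hH hh) hy
  have h2 : a * y * a⁻¹ = h * y * h⁻¹ := by
    rw [← hea]
    calc e * h * y * (e * h)⁻¹ = e * (h * y * h⁻¹) * e⁻¹ := by group
      _ = h * y * h⁻¹ := by rw [hcomm _ he _ h1, mul_inv_cancel_right]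
  rw [h2]
  exact mul_mem (mul_mem hh hyH) (inv_mem hh)

/-- A complement of the irreducible normal subgroup `E` is a maximal subgroup. -/
lemma covBy_of_complement {C : Subgroup SignedPerm} (hinf : E ⊓ C = ⊥) (hsup : E ⊔ C = G) :
    C ⋖ G := by
  have hC : C ≤ G := hsup ▸ le_sup_right
  refine covBy_of_eq_or_eq (lt_of_le_of_ne hC ?_) fun H h1 h2 => or_iff_not_imp_left.2 fun hne => ?_
  · rintro rfl
    have : n1 ∈ E ⊓ G := ⟨n1_mem_E, E_le_G n1_mem_E⟩
    rw [hinf] at this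
    exact n1_ne_one this
  have hsupH : E ⊔ H = G := le_antisymm (sup_le E_le_G h2) (hsup ▸ sup_le_sup_left h1 E)
  have hEH : E ≤ H := by
    refine E_le_of_inf_ne_bot h2 hsupH fun hbot => hne (le_antisymm (fun x hx => ?_) h1)
    have hxG : x ∈ E ⊔ C := hsup ▸ h2 hx
    obtain ⟨e, he, y, hy, rfl⟩ := (mem_sup_of_le_normalizer (hC.trans G_le_normalizer_E)).1 hxG
    have heH : e ∈ E ⊓ H := ⟨he, (mul_mem_cancel_right (h1 hy)).1 hx⟩
    rw [hbot, Subgroup.mem_bot] at heH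
    rwa [heH, one_mul]
  rw [← hsupH, sup_eq_right.2 hEH]

lemma maxRep_covBy (i : Fin 5) : maxRep i ⋖ G := by
  fin_cases i
  exacts [M1_covBy, M2_covBy, M3_covBy, covBy_of_complement E_inf_P E_sup_P,
    covBy_of_complement E_inf_Q E_sup_Q]

/-- The cohomological heart of the classification: up to conjugation by `E` a complement contains
`α̃`, as `α̃` acts on `E` without fixed points; then it contains `β̃`, which normalizes `⟨α̃⟩`; and
then it contains `γ̃` or `δ = N_6 γ̃`, as the orders 2 and 3 of `γ̃` and `β̃ α̃ γ̃` leave no other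
element of `E γ̃`. -/
lemma exists_conj_of_complement {M : Subgroup SignedPerm} (hinf : E ⊓ M = ⊥) (hsup : E ⊔ M = G) :
    ∃ g ∈ G, P ≤ M.map (MulAut.conj g).toMonoidHom ∨ Q ≤ M.map (MulAut.conj g).toMonoidHom := by
  have hM : M ≤ G := hsup ▸ le_sup_right
  -- `M` covers `G / E`, as does its conjugate below
  have cover : ∀ x ∈ G, ∃ v, signHom v * x ∈ M := by
    intro x hx
    rw [← hsup, mem_sup_of_le_normalizer (hM.trans G_le_normalizer_E)] at hx
    obtain ⟨e, he, m, hm, rfl⟩ := hx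
    obtain ⟨v, hv⟩ := mem_E_iff.1 (inv_mem he)
    exact ⟨v, by simpa [hv] using hm⟩
  obtain ⟨v, hv⟩ := cover a (P_le_G a_mem_P)
  have key1 : ∀ v, ∃ w, signHom w * (signHom v * a) * (signHom w)⁻¹ = a := by decide +kernel
  obtain ⟨w, hw⟩ := key1 v
  have hwE : signHom w ∈ E := mem_E_iff.2 ⟨w, rfl⟩
  refine ⟨signHom w, E_le_G hwE, ?_⟩
  set M' := M.map (MulAut.conj (signHom w)).toMonoidHom with hM'
  have haM : a ∈ M' := ⟨_, hv, hw⟩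
  have hinf' : ∀ x ∈ M', x ∈ E → x = 1 := by
    rintro _ ⟨x, hx, rfl⟩ hxE
    have h1 : x ∈ E := by
      have := mul_mem (mul_mem (inv_mem hwE) hxE) hwE
      simpa [mul_assoc] using this
    have h2 : x ∈ E ⊓ M := ⟨h1, hx⟩
    rw [hinf, Subgroup.mem_bot] at h2
    simp [h2]
  have cover' : ∀ x ∈ G, ∃ v, signHom v * x ∈ M' := by
    intro x hx
    obtain ⟨v, hv⟩ := cover _ (mul_mem (mul_mem (E_le_G (inv_mem hwE)) hx) (E_le_G hwE))
    refine ⟨w * v * w⁻¹, mem_map_conj.2 ?_⟩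
    have : (signHom w)⁻¹ * (signHom (w * v * w⁻¹) * x) * signHom w
        = signHom v * ((signHom w)⁻¹ * x * signHom w) := by
      simp only [map_mul, map_inv]
      group
    rwa [this]
  have hbM : b ∈ M' := by
    obtain ⟨u, hu⟩ := cover' b (P_le_G b_mem_P)
    have key2 : ∀ u, (∃ u', signHom u' = signHom u * b * a * (signHom u * b)⁻¹ * (a ^ 4)⁻¹) ∧
        (signHom u * b * a * (signHom u * b)⁻¹ * (a ^ 4)⁻¹ = 1 → signHom u * b = b) := by
      decide +kernel
    have h1 := hinf' _ (mul_mem (mul_mem (mul_mem hu haM) (inv_mem hu)) (inv_mem (pow_mem haM 4)))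
      (mem_E_iff.2 (key2 u).1)
    rwa [(key2 u).2 h1] at hu
  obtain ⟨u, hu⟩ := cover' c (P_le_G c_mem_P)
  have key3 : ∀ u, (∃ u', signHom u' = (signHom u * c) ^ 2) ∧
      (∃ u', signHom u' = (b * a * (signHom u * c)) ^ 3) ∧
      ((signHom u * c) ^ 2 = 1 → (b * a * (signHom u * c)) ^ 3 = 1 →
        signHom u * c = c ∨ signHom u * c = d) := by decide +kernel
  obtain ⟨h1, h2, h3⟩ := key3 u
  rcases h3 (hinf' _ (pow_mem hu 2) (mem_E_iff.2 h1))
    (hinf' _ (pow_mem (mul_mem (mul_mem hbM haM) hu) 3) (mem_E_iff.2 h2)) with h | h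
  · rw [h] at hu
    refine .inl ((Subgroup.closure_le _).2 ?_)
    rintro _ (rfl | rfl | rfl) <;> assumption
  · rw [h] at hu
    refine .inr ((Subgroup.closure_le _).2 ?_)
    rintro _ (rfl | rfl | rfl) <;> assumption

lemma conjugateIn_of_map_conj_le {N M : Subgroup SignedPerm} {g : SignedPerm} (hg : g ∈ G)
    (hM : M ⋖ G) (hN : N ⋖ G) (h : M.map (MulAut.conj g).toMonoidHom ≤ N) :
    ConjugateIn G N M := by
  refine ⟨g⁻¹, inv_mem hg, ?_⟩
  have h1 : M ≤ N.map (MulAut.conj g⁻¹).toMonoidHom := by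
    intro x hx
    rw [mem_map_conj, inv_inv]
    exact h ⟨x, hx, rfl⟩
  have h2 : N.map (MulAut.conj g⁻¹).toMonoidHom < G := map_conj_lt (inv_mem hg) hN.lt
  exact (hM.eq_or_eq h1 h2.le).resolve_right h2.ne

theorem exists_conjugateIn_maxRep {M : Subgroup SignedPerm} (hM : M ⋖ G) :
    ∃ i, ConjugateIn G (maxRep i) M := by
  by_cases hE : E ≤ M
  · have hne : M.map toPerm ≠ L := fun h => hM.lt.ne <| by
      rw [← lift_map_toPerm hE hM.lt.le, h, lift_L]
    obtain ⟨g, hg, h⟩ := isConjSmall_of_ne (map_toPerm_le_L hM.lt.le) hne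
    have hgG : ofPerm g ∈ G := map_ofPerm_le_G le_rfl ⟨g, hg, rfl⟩
    have key : ∀ A ≤ L, (M.map toPerm).map (MulAut.conj g).toMonoidHom ≤ A →
        M.map (MulAut.conj (ofPerm g)).toMonoidHom ≤ lift A := by
      rintro A hA h _ ⟨x, hx, rfl⟩
      refine (mem_lift_iff hA).2
        ⟨mul_mem (mul_mem hgG (hM.lt.le hx)) (inv_mem hgG), h ⟨toPerm x, ⟨x, hx, rfl⟩, ?_⟩⟩
      simp
    rcases h with h | h | h
    · exact ⟨0, conjugateIn_of_map_conj_le hgG hM M1_covBy ((key _ LF_le h).trans M1_eq_lift.ge)⟩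
    · exact ⟨1, conjugateIn_of_map_conj_le hgG hM M2_covBy ((key _ LS_le h).trans M2_eq_lift.ge)⟩
    · exact ⟨2, conjugateIn_of_map_conj_le hgG hM M3_covBy ((key _ LT_le h).trans M3_eq_lift.ge)⟩
  · have hsup : E ⊔ M = G := (hM.eq_or_eq le_sup_right (sup_le E_le_G hM.lt.le)).resolve_left
      fun h => hE (sup_eq_right.1 h)
    have hinf : E ⊓ M = ⊥ := by
      by_contra hne
      exact hE (E_le_of_inf_ne_bot hM.lt.le hsup hne)
    obtain ⟨g, hg, h⟩ := exists_conj_of_complement hinf hsup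
    have hlt : M.map (MulAut.conj g).toMonoidHom < G := map_conj_lt hg hM.lt
    rcases h with h | h
    · refine ⟨3, conjugateIn_of_map_conj_le hg hM (maxRep_covBy 3) ?_⟩
      exact ((maxRep_covBy 3).eq_or_eq h hlt.le).resolve_right hlt.ne |>.le
    · refine ⟨4, conjugateIn_of_map_conj_le hg hM (maxRep_covBy 4) ?_⟩
      exact ((maxRep_covBy 4).eq_or_eq h hlt.le).resolve_right hlt.ne |>.le

/-! ### The representatives are pairwise not conjugate -/

/-- Containing `E`, the normal subgroup, is a conjugacy invariant. -/
lemma E_le_iff_of_conjugateIn {M N : Subgroup SignedPerm} (h : ConjugateIn G M N) :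
    E ≤ M ↔ E ≤ N := by
  obtain ⟨g, hg, rfl⟩ := h
  constructor
  · intro hE x hx
    refine mem_map_conj.2 (hE ?_)
    simpa using conj_mem_E (inv_mem hg) hx
  · intro hE x hx
    have := mem_map_conj.1 (hE (conj_mem_E hg hx))
    simpa [mul_assoc] using this

/-- Fixing some coordinate up to sign is a conjugacy invariant. -/
lemma exists_fixed_coordinate_iff_of_conjugateIn {M N : Subgroup SignedPerm}
    (h : ConjugateIn G M N) :
    (∃ i, ∀ x ∈ M, toPerm x i = i) ↔ ∃ i, ∀ x ∈ N, toPerm x i = i := by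
  obtain ⟨g, -, rfl⟩ := h
  constructor
  · rintro ⟨i, hi⟩
    refine ⟨toPerm g i, ?_⟩
    rintro _ ⟨x, hx, rfl⟩
    simp only [MulEquiv.toMonoidHom_eq_coe, MonoidHom.coe_coe, MulAut.conj_apply, map_mul, map_inv,
      Equiv.Perm.mul_apply]
    rw [Equiv.Perm.inv_eq_iff_eq.2 rfl, hi x hx]
  · rintro ⟨i, hi⟩
    refine ⟨(toPerm g)⁻¹ i, fun x hx => ?_⟩
    have := hi _ ⟨x, hx, rfl⟩
    simp only [MulEquiv.toMonoidHom_eq_coe, MonoidHom.coe_coe, MulAut.conj_apply, map_mul, map_inv,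
      Equiv.Perm.mul_apply] at this
    rw [Equiv.Perm.eq_inv_iff_eq, this]

/-- Centralizing some involution of `E` is a conjugacy invariant. -/
lemma exists_central_of_conjugateIn {M N : Subgroup SignedPerm} (h : ConjugateIn G M N) :
    (∃ e ∈ E, e ≠ 1 ∧ ∀ x ∈ M, x * e = e * x) → ∃ e ∈ E, e ≠ 1 ∧ ∀ x ∈ N, x * e = e * x := by
  obtain ⟨g, hg, rfl⟩ := h
  rintro ⟨e, he, he1, hx⟩
  refine ⟨g * e * g⁻¹, conj_mem_E hg he, by simpa using he1, ?_⟩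
  rintro _ ⟨x, hxM, rfl⟩
  calc g * x * g⁻¹ * (g * e * g⁻¹) = g * (x * e) * g⁻¹ := by group
    _ = g * (e * x) * g⁻¹ := by rw [hx x hxM]
    _ = g * e * g⁻¹ * (g * x * g⁻¹) := by group

lemma ConjugateIn.symm {X : Type} [Group X] {H A B : Subgroup X} (h : ConjugateIn H A B) :
    ConjugateIn H B A := by
  obtain ⟨g, hg, rfl⟩ := h
  refine ⟨g⁻¹, inv_mem hg, ?_⟩
  rw [map_conj_map_conj, inv_mul_cancel, map_conj_of_mem (one_mem _)]

lemma not_E_le_of_inf_eq_bot {C : Subgroup SignedPerm} (h : E ⊓ C = ⊥) : ¬ E ≤ C := by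
  intro hE
  rw [inf_eq_left.2 hE] at h
  have := n1_mem_E
  rw [h] at this
  exact n1_ne_one this

/-- `M2` centralizes `N_6`, whereas `α̃ ∈ M1` centralizes no involution of `E`. -/
lemma not_conjugateIn_M1_M2 : ¬ ConjugateIn G M1 M2 := by
  intro h
  have h2 : ∃ e ∈ E, e ≠ 1 ∧ ∀ x ∈ M2, x * e = e * x := by
    refine ⟨n6, n6_mem_E, by decide +kernel, fun x hx => ?_⟩
    have : M2 ≤ Subgroup.centralizer {n6} := by
      refine (Subgroup.closure_le _).2 ?_
      rintro _ (rfl | rfl | rfl) <;>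
        exact Subgroup.mem_centralizer_singleton_iff.2 (by decide +kernel)
    exact Subgroup.mem_centralizer_singleton_iff.1 (this hx)
  obtain ⟨e, he, he1, hx⟩ := exists_central_of_conjugateIn (ConjugateIn.symm h) h2
  obtain ⟨v, rfl⟩ := mem_E_iff.1 he
  have h3 := hx a (Subgroup.subset_closure (by simp))
  have key : ∀ v, a * signHom v = signHom v * a → signHom v = 1 := by decide +kernel
  exact he1 (key v h3)

lemma exists_fixed_coordinate_M3 : ∃ i, ∀ x ∈ M3, toPerm x i = i :=
  ⟨6, fun x hx => mem_stabLast.1 (LT_le_stabLast (by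
    rw [M3_eq_lift] at hx
    exact ((mem_lift_iff LT_le).1 hx).2))⟩

/-- `M3` fixes the last coordinate, whereas `α̃ ∈ M1` fixes none. -/
lemma not_conjugateIn_M1_M3 : ¬ ConjugateIn G M1 M3 := by
  intro h
  obtain ⟨i, hi⟩ := (exists_fixed_coordinate_iff_of_conjugateIn h).2 exists_fixed_coordinate_M3
  have h1 : pa i = i := hi a (Subgroup.subset_closure (by simp))
  have key : ∀ i, pa i ≠ i := by decide +kernel
  exact key i h1

/-- `M3` fixes the last coordinate, whereas `γ̃, θ̃ ∈ M2` have no common fixed coordinate. -/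
lemma not_conjugateIn_M2_M3 : ¬ ConjugateIn G M2 M3 := by
  intro h
  obtain ⟨i, hi⟩ := (exists_fixed_coordinate_iff_of_conjugateIn h).2 exists_fixed_coordinate_M3
  have h1 : pc i = i := hi c (Subgroup.subset_closure (by simp))
  have h2 : pt i = i := hi t (Subgroup.subset_closure (by simp))
  have key : ∀ i, pc i = i → pt i ≠ i := by decide +kernel
  exact key i h1 h2

/-- The pure permutations fix the all-ones vector, while no vector of signs is fixed by
`⟨α̃, β̃, δ⟩`. -/
lemma not_conjugateIn_P_Q : ¬ ConjugateIn G P Q := by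
  rintro ⟨g, -, hg⟩
  have fixed : ∀ x ∈ Q, ∀ j, x.left j * g.left (x.right⁻¹ j) = g.left j := by
    intro x hx j
    rw [← hg, mem_map_conj] at hx
    obtain ⟨σ, hσ⟩ := P_le_range_ofPerm hx
    have h1 : x * g = g * ofPerm σ := by
      rw [hσ]
      group
    have h2 : (x * g).left j = (g * ofPerm σ).left j := by rw [h1]
    have h3 : (g * ofPerm σ).left j = g.left j := by simp
    rw [← h3, ← h2]
    rfl
  have ha : ∀ j, g.left (pa⁻¹ j) = g.left j := fun j =>
    (one_mul _).symm.trans (fixed a a_mem_Q j)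
  have h1 : g.left 4 = g.left 0 := by
    have h0 : g.left 4 = g.left 6 := ha 6
    exact h0.trans (ha 0)
  have h2 : -1 * g.left 4 = g.left 0 := fixed d d_mem_Q 0
  rw [h1] at h2
  rcases Int.units_eq_one_or (g.left 0) with h | h <;> rw [h] at h2 <;> revert h2 <;> decide

theorem not_conjugateIn_maxRep {i j : Fin 5} (hij : i ≠ j) :
    ¬ ConjugateIn G (maxRep i) (maxRep j) := by
  wlog hlt : i < j generalizing i j
  · exact fun h => this hij.symm (lt_of_le_of_ne (not_lt.1 hlt) hij.symm) (ConjugateIn.symm h)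
  have hE : ∀ M C : Subgroup SignedPerm, E ≤ M → E ⊓ C = ⊥ → ¬ ConjugateIn G M C :=
    fun M C hM hC h => not_E_le_of_inf_eq_bot hC ((E_le_iff_of_conjugateIn h).1 hM)
  have h1 : E ≤ M1 := M1_eq_lift ▸ le_sup_left
  have h2 : E ≤ M2 := M2_eq_lift ▸ le_sup_left
  have h3 : E ≤ M3 := M3_eq_lift ▸ le_sup_left
  fin_cases i <;> fin_cases j <;> first | exact absurd hlt (by decide) | skip
  exacts [not_conjugateIn_M1_M2, not_conjugateIn_M1_M3, hE _ _ h1 E_inf_P, hE _ _ h1 E_inf_Q,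
    not_conjugateIn_M2_M3, hE _ _ h2 E_inf_P, hE _ _ h2 E_inf_Q,
    hE _ _ h3 E_inf_P, hE _ _ h3 E_inf_Q, not_conjugateIn_P_Q]

/-! ### Structure of the maximal subgroups -/

/-- The preimage of a subgroup of `L` splits over `E`. -/
lemma isSplitExtension_lift {A : Subgroup (Equiv.Perm (Fin 7))} (hA : A ≤ L) :
    IsSplitExtension (lift A) E (A.map ofPerm) :=
  isSplitExtension_of_le_normalizer ((map_ofPerm_le_G hA).trans G_le_normalizer_E)
    (eq_bot_mono (inf_le_inf_left _ (Subgroup.map_le_range _ _)) E_inf_range_ofPerm) rfl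

lemma isSplitExtension_M1 : IsSplitExtension M1 E F := by
  rw [M1_eq_lift, ← map_ofPerm_LF]
  exact isSplitExtension_lift LF_le

lemma isSplitExtension_M2 : IsSplitExtension M2 E S := by
  rw [M2_eq_lift, ← map_ofPerm_LS]
  exact isSplitExtension_lift LS_le

lemma orderOf_a : orderOf a = 7 := (orderOf_injective _ ofPerm_injective pa).trans orderOf_pa

lemma orderOf_b : orderOf b = 3 := (orderOf_injective _ ofPerm_injective pb).trans orderOf_pb

lemma isSplitExtension_F :
    IsSplitExtension F (Subgroup.zpowers a) (Subgroup.zpowers b) := by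
  refine isSplitExtension_of_le_normalizer ?_ ?_ ?_
  · rw [Subgroup.zpowers_le]
    refine Subgroup.mem_normalizer_fintype fun y hy => ?_
    obtain ⟨k, rfl⟩ := hy
    rw [show b * a ^ k * b⁻¹ = (b * a * b⁻¹) ^ k by rw [conj_zpow],
      bruhatRelations_abc.b_mul_a, mul_inv_cancel_right]
    exact zpow_mem (pow_mem (Subgroup.mem_zpowers a) 4) k
  · refine (Subgroup.disjoint_of_coprime_natCard ?_).eq_bot
    rw [Nat.card_zpowers, Nat.card_zpowers, orderOf_a, orderOf_b]
    norm_num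
  · rw [F, Set.insert_eq, Subgroup.closure_union, Subgroup.zpowers_eq_closure,
      Subgroup.zpowers_eq_closure]

lemma nonempty_equiv_S : Nonempty (S ≃* Equiv.Perm (Fin 4)) :=
  ⟨((LS.equivMapOfInjective _ ofPerm_injective).trans
    (MulEquiv.subgroupCongr map_ofPerm_LS)).symm.trans equivLS⟩

lemma nonempty_equiv_T : Nonempty (T ≃* Equiv.Perm (Fin 4)) :=
  ⟨((LT.equivMapOfInjective _ ofPerm_injective).trans
    (MulEquiv.subgroupCongr map_ofPerm_LT)).symm.trans equivLT⟩

lemma E4_le_E : E4 ≤ E := by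
  refine (Subgroup.closure_le _).2 ?_
  rintro _ (rfl | rfl)
  exacts [n2_mem_E, mul_mem n7_mem_E n1_mem_E]

lemma T_le_range_ofPerm : T ≤ ofPerm.range := map_ofPerm_LT ▸ Subgroup.map_le_range _ _

lemma mem_normalizer_E4 {x : SignedPerm} (h : ∀ v, ∃ v', x * signHom4 v * x⁻¹ = signHom4 v') :
    x ∈ Subgroup.normalizer E4 := by
  refine Subgroup.mem_normalizer_fintype fun y hy => ?_
  obtain ⟨v, rfl⟩ := mem_E4_iff.1 hy
  obtain ⟨v', hv⟩ := h v
  exact mem_E4_iff.2 ⟨v', hv.symm⟩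

lemma isSplitExtension_E4_sup_T : IsSplitExtension (E4 ⊔ T) E4 T := by
  refine isSplitExtension_of_le_normalizer ((Subgroup.closure_le _).2 ?_)
    (eq_bot_mono (inf_le_inf E4_le_E T_le_range_ofPerm) E_inf_range_ofPerm) rfl
  rintro _ (rfl | rfl) <;> exact mem_normalizer_E4 (by decide +kernel)

lemma orderOf_n1 : orderOf n1 = 2 := orderOf_eq_prime (by decide +kernel) (by decide +kernel)

/-- The signed permutations fixing the last basis vector. They contain `⟨N_2, N_4⟩` and `⟨Ã, B̃⟩`
but not `N_1`. -/
def fixLast : Subgroup SignedPerm where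
  carrier := {x | x.right 6 = 6 ∧ x.left 6 = 1}
  one_mem' := ⟨rfl, rfl⟩
  mul_mem' := by
    rintro x y ⟨h1, h2⟩ ⟨h3, h4⟩
    refine ⟨?_, ?_⟩
    · change x.right (y.right 6) = 6
      rw [h3, h1]
    · change x.left 6 * y.left (x.right⁻¹ 6) = 1
      rw [h2, Equiv.Perm.inv_eq_iff_eq.2 h1.symm, h4, one_mul]
  inv_mem' := by
    rintro x ⟨h1, h2⟩
    have h3 : x.right⁻¹ 6 = 6 := Equiv.Perm.inv_eq_iff_eq.2 h1.symm
    refine ⟨h3, ?_⟩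
    change (x.left (x.right⁻¹⁻¹ 6))⁻¹ = 1
    rw [inv_inv, h1, h2, inv_one]

lemma E4_sup_T_le_fixLast : E4 ⊔ T ≤ fixLast := by
  refine sup_le ((Subgroup.closure_le _).2 ?_) ((Subgroup.closure_le _).2 ?_) <;>
  · rintro _ (rfl | rfl)
    exacts [⟨by decide +kernel, by decide +kernel⟩, ⟨by decide +kernel, by decide +kernel⟩]

/-- `N_1` normalizes `⟨N_2, N_4⟩:⟨Ã, B̃⟩`, since its commutators with `Ã` and `B̃` lie in
`⟨N_2, N_4⟩`. -/
lemma n1_mem_normalizer : n1 ∈ Subgroup.normalizer (E4 ⊔ T : Subgroup SignedPerm) := by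
  have h4 : ∀ x ∈ E4, n1 * x * n1⁻¹ ∈ E4 := by
    intro x hx
    obtain ⟨v, rfl⟩ := mem_E4_iff.1 hx
    have key : ∀ v, ∃ w, signHom4 w = n1 * signHom4 v * n1⁻¹ := by decide +kernel
    exact mem_E4_iff.2 (key v)
  have hA : A ∈ T := Subgroup.subset_closure (by simp)
  have hB : B ∈ T := Subgroup.subset_closure (by simp)
  have key : E4 ⊔ T ≤ (E4 ⊔ T).comap (MulAut.conj n1).toMonoidHom := by
    refine sup_le (fun x hx => Subgroup.mem_sup_left (h4 x hx)) ((Subgroup.closure_le _).2 ?_)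
    rintro _ (rfl | rfl)
    · have h1 : n1 * A * n1⁻¹ * A⁻¹ ∈ E4 :=
        mem_E4_iff.2 (by decide +kernel : ∃ v, signHom4 v = n1 * A * n1⁻¹ * A⁻¹)
      have h2 := mul_mem (Subgroup.mem_sup_left h1) (Subgroup.mem_sup_right (S := E4) hA)
      simpa using h2
    · have h1 : n1 * B * n1⁻¹ * B⁻¹ ∈ E4 :=
        mem_E4_iff.2 (by decide +kernel : ∃ v, signHom4 v = n1 * B * n1⁻¹ * B⁻¹)
      have h2 := mul_mem (Subgroup.mem_sup_left h1) (Subgroup.mem_sup_right (S := E4) hB)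
      simpa using h2
  exact Subgroup.mem_normalizer_fintype fun x hx => key hx

lemma isSplitExtension_M3 :
    IsSplitExtension M3 (E4 ⊔ T) (Subgroup.zpowers n1) := by
  refine isSplitExtension_of_le_normalizer (Subgroup.zpowers_le.2 n1_mem_normalizer) ?_ ?_
  · -- `⟨N_1⟩` has prime order and is not contained in `E4 ⊔ T`
    rw [eq_bot_iff]
    rintro _ ⟨hx, k, rfl⟩
    have h1 : n1 ^ (2 : ℤ) = 1 := by decide +kernel
    rcases Int.even_or_odd' k with ⟨m, rfl | rfl⟩
    · simp [zpow_mul, h1]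
    · have h2 : n1 ∈ E4 ⊔ T := by simpa [zpow_add, zpow_mul, h1] using hx
      exact absurd (E4_sup_T_le_fixLast h2).2 (by decide +kernel)
  · have hA : A ∈ M3 := Subgroup.subset_closure (by simp)
    have hB : B ∈ M3 := Subgroup.subset_closure (by simp)
    have hE : E ≤ M3 := M3_eq_lift ▸ le_sup_left
    refine le_antisymm (sup_le (sup_le (E4_le_E.trans hE) ((Subgroup.closure_le _).2 ?_))
      (Subgroup.zpowers_le.2 (hE n1_mem_E))) ((Subgroup.closure_le _).2 ?_)
    · rintro _ (rfl | rfl) <;> assumption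
    · rintro _ (rfl | rfl | rfl)
      exacts [Subgroup.mem_sup_left (Subgroup.mem_sup_right (Subgroup.subset_closure (by simp))),
        Subgroup.mem_sup_left (Subgroup.mem_sup_right (Subgroup.subset_closure (by simp))),
        Subgroup.mem_sup_right (Subgroup.mem_zpowers _)]

/-! ### The isomorphism with `PSL_2(7)` -/

/-- All complements of `E` in `G` are isomorphic to `L`. -/
lemma nonempty_equiv_L {C : Subgroup SignedPerm} (hinf : E ⊓ C = ⊥) (hsup : E ⊔ C = G) :
    Nonempty (C ≃* L) := by
  have hinj : Function.Injective (toPerm.comp C.subtype) := by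
    rw [injective_iff_map_eq_one]
    rintro ⟨x, hx⟩ h
    have h1 : x ∈ E ⊓ C := ⟨mem_E_of_toPerm_eq_one (hsup ▸ Subgroup.mem_sup_right hx) h, hx⟩
    rw [hinf, Subgroup.mem_bot] at h1
    exact Subtype.ext h1
  have hrange : (toPerm.comp C.subtype).range = L := by
    rw [MonoidHom.range_comp, Subgroup.range_subtype, ← map_toPerm_lift L, lift_L, ← hsup,
      Subgroup.map_sup, (Subgroup.map_eq_bot_iff _).2 E_le_ker, bot_sup_eq]
  exact ⟨(MonoidHom.ofInjective hinj).trans (MulEquiv.subgroupCongr hrange)⟩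

/-- The group `SL_2(7)`. -/
abbrev SL27 : Type := Matrix.SpecialLinearGroup (Fin 2) (ZMod 7)

instance : Fact (Nat.Prime 7) := ⟨by norm_num⟩

lemma card_SL27_le : Nat.card SL27 ≤ 336 := by
  have hsurj : Function.Surjective
      (Matrix.GeneralLinearGroup.det : GL (Fin 2) (ZMod 7) →* (ZMod 7)ˣ) := by
    intro u
    refine ⟨Matrix.GeneralLinearGroup.mkOfDetNeZero !![(u : ZMod 7), 0; 0, 1] (by simp), ?_⟩
    ext
    simp [Matrix.GeneralLinearGroup.mkOfDetNeZero]
  have h1 := Subgroup.card_eq_card_quotient_mul_card_subgroup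
    (Matrix.GeneralLinearGroup.det : GL (Fin 2) (ZMod 7) →* (ZMod 7)ˣ).ker
  have h2 : Nat.card (ZMod 7)ˣ = 6 := by
    rw [Nat.card_eq_fintype_card, ZMod.card_units]
  rw [Nat.card_congr (QuotientGroup.quotientKerEquivOfSurjective _ hsurj).toEquiv, h2,
    Matrix.card_GL_field] at h1
  rw [Fin.prod_univ_two, ZMod.card] at h1
  change (7 ^ 2 - 7 ^ 0) * (7 ^ 2 - 7 ^ 1) = _ at h1
  have h3 : Nat.card SL27 ≤
      Nat.card (Matrix.GeneralLinearGroup.det : GL (Fin 2) (ZMod 7) →* (ZMod 7)ˣ).ker := by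
    refine Nat.card_le_card_of_injective
      (fun m => ⟨Matrix.SpecialLinearGroup.toGL m, by
        rw [MonoidHom.mem_ker]
        ext
        simp⟩) fun m m' h => ?_
    exact Matrix.SpecialLinearGroup.toGL_injective (congrArg Subtype.val h)
  omega

lemma card_PSL27_le :
    Nat.card (Matrix.ProjectiveSpecialLinearGroup (Fin 2) (ZMod 7)) ≤ 168 := by
  have h1 := Subgroup.card_eq_card_quotient_mul_card_subgroup (Subgroup.center SL27)
  have h2 := card_SL27_le
  have h3 : 1 < Nat.card (Subgroup.center SL27) := by
    rw [Subgroup.one_lt_card_iff_ne_bot, Ne, Subgroup.eq_bot_iff_forall]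
    intro h
    have : (-1 : SL27) ∈ Subgroup.center SL27 :=
      Subgroup.mem_center_iff.2 fun g => by simp
    have h4 := congrArg (fun m : SL27 => m.1 0 0) (h _ this)
    revert h4
    decide
  change Nat.card (SL27 ⧸ Subgroup.center SL27) ≤ 168
  nlinarith

/-- The eight sign vectors in the orbit of the all-ones vector under `G`, labelled by the points of
the projective line over `ZMod 7`, given in homogeneous coordinates: the point at infinity stands
for the all-ones vector, `0` for its image under `δ`, and `k` for the image of the latter under
`α̃ ^ k`. Since `y ^ 5` is the inverse of `y`, the affine coordinate of `(x : y)` is `x * y ^ 5`. -/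
def word (v : Fin 2 → ZMod 7) : Fin 7 → ℤˣ :=
  if v 1 = 0 then 1 else (a ^ (v 0 * v 1 ^ 5).val * d).left

lemma left_mul_ofSigns (x y : SignedPerm) : (x * y).left = (x * ofSigns y.left).left := by
  simp

/-- The group of pairs of a signed permutation and a matrix that act in the same way on the
projective line over `ZMod 7`. -/
def compatible : Subgroup (SignedPerm × SL27) where
  carrier := {p | ∀ v ≠ 0, (p.1 * ofSigns (word v)).left = word (p.2.1.mulVec v)}
  one_mem' v _ := by simp
  mul_mem' := by
    rintro ⟨x, m⟩ ⟨y, n⟩ hx hy v hv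
    have hnv : n.1.mulVec v ≠ 0 := fun h => hv <| by
      have := congrArg (n⁻¹.1.mulVec) h
      rwa [Matrix.mulVec_mulVec, ← Matrix.SpecialLinearGroup.coe_mul, inv_mul_cancel,
        Matrix.SpecialLinearGroup.coe_one, Matrix.one_mulVec, Matrix.mulVec_zero] at this
    change (x * y * ofSigns (word v)).left = word ((m.1 * n.1).mulVec v)
    rw [mul_assoc, left_mul_ofSigns, hy v hv, hx _ hnv, Matrix.mulVec_mulVec]
  inv_mem' := by
    rintro ⟨x, m⟩ hx v hv
    have hmv : m.1.mulVec (m⁻¹.1.mulVec v) = v := by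
      rw [Matrix.mulVec_mulVec, ← Matrix.SpecialLinearGroup.coe_mul, mul_inv_cancel,
        Matrix.SpecialLinearGroup.coe_one, Matrix.one_mulVec]
    have hmv0 : m⁻¹.1.mulVec v ≠ 0 := fun h => hv <| by rw [← hmv, h, Matrix.mulVec_zero]
    have h1 := hx _ hmv0
    change (x * _).left = _ at h1
    rw [hmv] at h1
    change (x⁻¹ * ofSigns (word v)).left = word (m⁻¹.1.mulVec v)
    rw [← h1, ← left_mul_ofSigns, inv_mul_cancel_left]
    simp

lemma mem_compatible {x : SignedPerm} {m : SL27} : (x, m) ∈ compatible ↔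
    ∀ v ≠ 0, (x * ofSigns (word v)).left = word (m.1.mulVec v) := Iff.rfl

/-- Both `G` and `SL_2(7)` act on the projective line; the kernel of the first action is trivial,
and that of the second is the centre. -/
lemma eq_one_iff_mem_center {x : SignedPerm} {m : SL27} (h : (x, m) ∈ compatible) :
    x = 1 ↔ m ∈ Subgroup.center SL27 := by
  rw [mem_compatible] at h
  rw [Matrix.SpecialLinearGroup.mem_center_iff]
  constructor
  · rintro rfl
    have h' : ∀ v ≠ 0, word v = word (m.1.mulVec v) := fun v hv => by
      rw [← h v hv]
      simp
    have hd := m.2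
    rw [Matrix.det_fin_two] at hd
    -- the points `(1 : 0)` and `(0 : 1)` are fixed, so the matrix is diagonal
    have key1 : ∀ r p, word ![1, 0] = word ![p, r] → r = 0 := by decide +kernel
    have key2 : ∀ q s, word ![0, 1] = word ![q, s] → q * s = 0 := by decide +kernel
    -- the point `(1 : 1)` is fixed, so the two eigenvalues agree
    have key3 : ∀ p s, p * s = 1 → word ![1, 1] = word ![p, s] → p = s := by decide +kernel
    have e1 := h' ![1, 0] (by decide)
    have e2 := h' ![0, 1] (by decide)
    have e3 := h' ![1, 1] (by decide)
    rw [show m.1.mulVec ![1, 0] = ![m.1 0 0, m.1 1 0] by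
      funext i; fin_cases i <;> simp [Matrix.mulVec, dotProduct]] at e1
    have hr := key1 _ _ e1
    rw [hr, mul_zero, sub_zero] at hd
    rw [show m.1.mulVec ![0, 1] = ![m.1 0 1, m.1 1 1] by
      funext i; fin_cases i <;> simp [Matrix.mulVec, dotProduct]] at e2
    have hq := (mul_eq_zero.1 (key2 _ _ e2)).resolve_right (right_ne_zero_of_mul_eq_one hd)
    rw [show m.1.mulVec ![1, 1] = ![m.1 0 0, m.1 1 1] by
      funext i; fin_cases i <;> simp [Matrix.mulVec, dotProduct, hr, hq]] at e3
    have hs := key3 _ _ hd e3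
    refine ⟨m.1 0 0, ?_, ?_⟩
    · rw [Fintype.card_fin, pow_two]
      nth_rewrite 2 [hs]
      exact hd
    · ext i j
      fin_cases i <;> fin_cases j <;> simp [hr, hq, hs]
  · rintro ⟨r, hr, hm⟩
    have hr0 : r ≠ 0 := by
      rintro rfl
      simp at hr
    have hword : ∀ r : ZMod 7, r ≠ 0 → ∀ v, word (r • v) = word v := by decide +kernel
    have h' : ∀ v ≠ 0, (x * ofSigns (word v)).left = word v := fun v hv => by
      rw [h v hv, ← hm, ← hword r hr0 v]
      congr 1
      ext i
      simp [Matrix.scalar_apply, Matrix.mulVec_diagonal]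
    have hx : x = ofPerm x.right := by
      have h1 := h' ![1, 0] (by decide)
      rw [show word ![1, 0] = 1 by decide +kernel, map_one, mul_one] at h1
      exact SemidirectProduct.ext h1 rfl
    refine eq_one_of_commute_E ⟨_, hx.symm⟩ fun e he => ?_
    obtain ⟨u, rfl⟩ := mem_E_iff.1 he
    have hE : ∀ u, ∃ v : Fin 2 → ZMod 7, v ≠ 0 ∧ signHom u = ofSigns (word v) := by decide +kernel
    obtain ⟨v, hv, hu⟩ := hE u
    rw [hu]
    refine SemidirectProduct.ext ?_ (by simp)
    rw [h' v hv, hx]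
    simp

/-- The pairs in `compatible` whose signed permutation lies in `⟨α̃, β̃, δ⟩`. -/
def compatibleQ : Subgroup (SignedPerm × SL27) := compatible ⊓ Q.prod ⊤

theorem nonempty_equiv_Q :
    Nonempty (Q ≃* Matrix.ProjectiveSpecialLinearGroup (Fin 2) (ZMod 7)) := by
  let f : compatibleQ →* Q := ((MonoidHom.fst SignedPerm SL27).comp compatibleQ.subtype).codRestrict
    Q fun p => (Subgroup.mem_prod.1 p.2.2).1
  let g : compatibleQ →* SL27 ⧸ Subgroup.center SL27 := (QuotientGroup.mk' _).comp
    ((MonoidHom.snd SignedPerm SL27).comp compatibleQ.subtype)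
  have hker : f.ker = g.ker := by
    ext ⟨⟨x, m⟩, hp⟩
    rw [MonoidHom.mem_ker, MonoidHom.mem_ker]
    have h1 : f ⟨(x, m), hp⟩ = 1 ↔ x = 1 := Subtype.ext_iff
    have h2 : g ⟨(x, m), hp⟩ = 1 ↔ m ∈ Subgroup.center SL27 := QuotientGroup.eq_one_iff m
    rw [h1, h2]
    exact eq_one_iff_mem_center hp.1
  have hf : Function.Surjective f := by
    have key : Q ≤ compatibleQ.map (MonoidHom.fst SignedPerm SL27) := by
      have ha : ∀ v, (a * ofSigns (word v)).left = word (!![1, 1; 0, 1].mulVec v) := by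
        decide +kernel
      have hb : ∀ v, (b * ofSigns (word v)).left = word (!![2, 1; 0, 4].mulVec v) := by
        decide +kernel
      have hd : ∀ v ≠ 0, (d * ofSigns (word v)).left = word (!![0, 3; 2, 0].mulVec v) := by
        decide +kernel
      refine (Subgroup.closure_le _).2 ?_
      rintro _ (rfl | rfl | rfl)
      · exact ⟨(a, ⟨!![1, 1; 0, 1], by decide⟩), ⟨fun v _ => ha v, a_mem_Q, trivial⟩, rfl⟩
      · exact ⟨(b, ⟨!![2, 1; 0, 4], by decide⟩), ⟨fun v _ => hb v, b_mem_Q, trivial⟩, rfl⟩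
      · exact ⟨(d, ⟨!![0, 3; 2, 0], by decide⟩), ⟨hd, d_mem_Q, trivial⟩, rfl⟩
    rintro ⟨x, hx⟩
    obtain ⟨p, hp, rfl⟩ := key hx
    exact ⟨⟨p, hp⟩, rfl⟩
  have hQ : Nat.card Q = 168 := by
    obtain ⟨e⟩ := nonempty_equiv_L E_inf_Q E_sup_Q
    rw [Nat.card_congr e.toEquiv, card_L]
  -- The image of `g` has the order of `Q`, which is at least that of `PSL_2(7)`.
  have hg : Function.Surjective g := by
    rw [← MonoidHom.range_eq_top]
    refine Subgroup.eq_top_of_le_card _ ?_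
    rw [← Nat.card_congr (QuotientGroup.quotientKerEquivRange g).toEquiv, ← hker,
      Nat.card_congr (QuotientGroup.quotientKerEquivOfSurjective f hf).toEquiv, hQ]
    exact card_PSL27_le
  exact ⟨(QuotientGroup.quotientKerEquivOfSurjective f hf).symm.trans
    ((QuotientGroup.quotientMulEquivOfEq hker).trans
      (QuotientGroup.quotientKerEquivOfSurjective g hg))⟩

theorem nonempty_equiv_P :
    Nonempty (P ≃* Matrix.ProjectiveSpecialLinearGroup (Fin 2) (ZMod 7)) := by
  obtain ⟨e⟩ := nonempty_equiv_L E_inf_P E_sup_P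
  obtain ⟨e'⟩ := nonempty_equiv_L E_inf_Q E_sup_Q
  obtain ⟨e''⟩ := nonempty_equiv_Q
  exact ⟨e.trans (e'.symm.trans e'')⟩

end SignedPerm

/-! ### Irreducibility -/

section Representation

variable {K : Type} [Field K]

lemma natRep_apply (H : Subgroup (GL7 K)) (g : H) (v : Fin 7 → K) : natRep H g v = g.1 v := rfl

/-- A representation on a nontrivial space is irreducible if a nonzero invariant subspace is
everything. -/
lemma isIrreducible_of_forall {Γ V : Type*} [Monoid Γ] [AddCommGroup V] [Module K V]
    [Nontrivial V] (ρ : Representation K Γ V)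
    (h : ∀ U : Submodule K V, (∀ g, ∀ u ∈ U, ρ g u ∈ U) → ∀ u ∈ U, u ≠ 0 → U = ⊤) :
    ρ.IsIrreducible where
  exists_pair_ne := by
    refine ⟨⊥, ⊤, fun he => ?_⟩
    exact bot_ne_top (α := Submodule K V) (congrArg Subrepresentation.toSubmodule he)
  eq_bot_or_eq_top U := by
    refine or_iff_not_imp_left.2 fun hU => ?_
    obtain ⟨u, hu, hu0⟩ := (Submodule.ne_bot_iff U.toSubmodule).1 fun he =>
      hU (Subrepresentation.toSubmodule_injective he)
    exact Subrepresentation.toSubmodule_injective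
      (h U.toSubmodule (fun g u hu => U.apply_mem_toSubmodule g hu) u hu hu0)

lemma toGL_ofPerm_apply (σ : Equiv.Perm (Fin 7)) (v : Fin 7 → K) (j : Fin 7) :
    toGL K (SignedPerm.ofPerm σ) v j = v (σ⁻¹ j) := by
  simp [toGL_apply]

/-- The powers of `α̃` move any coordinate to the last one. -/
lemma exists_toGL_pow_a_apply (u : Fin 7 → K) (i : Fin 7) :
    ∃ k : ℕ, toGL K (SignedPerm.a ^ k) u 6 = u i := by
  have key : ∀ i : Fin 7, ∃ k : Fin 7, (SignedPerm.pa ^ (k : ℕ))⁻¹ 6 = i := by decide +kernel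
  obtain ⟨k, hk⟩ := key i
  refine ⟨k, ?_⟩
  rw [SignedPerm.a, ← map_pow, toGL_ofPerm_apply, hk]

/-- The powers of `α̃` move the last basis vector to any other one. -/
lemma exists_toGL_pow_a_single (i : Fin 7) :
    ∃ k : ℕ, toGL K (SignedPerm.a ^ k) (Pi.single 6 1) = Pi.single i 1 := by
  have key : ∀ i : Fin 7, ∃ k : Fin 7, (SignedPerm.pa ^ (k : ℕ)) 6 = i := by decide +kernel
  obtain ⟨k, hk⟩ := key i
  refine ⟨k, funext fun j => ?_⟩
  rw [SignedPerm.a, ← map_pow, toGL_ofPerm_apply, Pi.single_apply, Pi.single_apply, ← hk]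
  simp only [Equiv.Perm.inv_eq_iff_eq]

lemma toGL_pow_a_one (k : ℕ) : toGL K (SignedPerm.a ^ k) 1 = 1 := by
  funext j
  rw [SignedPerm.a, ← map_pow, toGL_ofPerm_apply]
  rfl

lemma toGL_eq_of {w : SignedPerm} {ε : Fin 7 → ℤˣ} {τ : Fin 7 → Fin 7}
    (h : ∀ j, w.left j = ε j ∧ w.right⁻¹ j = τ j) (u : Fin 7 → K) :
    toGL K w u = fun j => ((ε j : ℤ) : K) * u (τ j) := by
  funext j
  rw [toGL_apply, (h j).1, (h j).2]

/-- The hyperplane of vectors with coordinate sum zero. -/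
def sumZero (K : Type) [Field K] : Submodule K (Fin 7 → K) :=
  LinearMap.ker (∑ i, LinearMap.proj i : (Fin 7 → K) →ₗ[K] K)

lemma mem_sumZero {v : Fin 7 → K} : v ∈ sumZero K ↔ ∑ i, v i = 0 := by
  simp [sumZero]

lemma exists_of_mem_P {g : GL7 K} (hg : g ∈ P K) :
    ∃ σ, g = toGL K (SignedPerm.ofPerm σ) := by
  rw [← map_P] at hg
  obtain ⟨w, hw, rfl⟩ := hg
  obtain ⟨σ, rfl⟩ := SignedPerm.P_le_range_ofPerm hw
  exact ⟨σ, rfl⟩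

variable [CharZero K]

/-- The stabilizer in `⟨α̃, β̃, δ⟩` of the line through the last basis vector `e` contains a
four-group acting trivially on it, and the sum of this four-group sends a vector `u` to
`4 u_7 • e`. Hence an invariant subspace contains `e` as soon as it is nonzero. -/
theorem isIrreducible_natRep_Q : (natRep (Q K)).IsIrreducible := by
  refine isIrreducible_of_forall _ fun U hU u hu hu0 => ?_
  have hU' : ∀ w ∈ SignedPerm.Q, ∀ u ∈ U, toGL K w u ∈ U := fun w hw u hu =>
    hU ⟨toGL K w, map_Q K ▸ ⟨w, hw, rfl⟩⟩ u hu
  have ha := SignedPerm.a_mem_Q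
  have hb := SignedPerm.b_mem_Q
  have hd := SignedPerm.d_mem_Q
  obtain ⟨i, hi⟩ := Function.ne_iff.1 hu0
  obtain ⟨k, hk⟩ := exists_toGL_pow_a_apply u i
  set u' := toGL K (SignedPerm.a ^ k) u with hu'
  have hu'U : u' ∈ U := hU' _ (pow_mem ha k) u hu
  have hu6 : u' 6 ≠ 0 := by rwa [hk]
  set x := SignedPerm.a * SignedPerm.b * SignedPerm.a * SignedPerm.d with hx
  set y := SignedPerm.b * SignedPerm.d * SignedPerm.b * SignedPerm.a with hy
  have hxQ : x ∈ SignedPerm.Q := mul_mem (mul_mem (mul_mem ha hb) ha) hd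
  have hyQ : y ∈ SignedPerm.Q := mul_mem (mul_mem (mul_mem hb hd) hb) ha
  have hx' := fun u : Fin 7 → K => toGL_eq_of (w := x) (ε := ![-1, -1, 1, -1, -1, 1, 1])
    (τ := ![0, 4, 5, 3, 1, 2, 6]) (by decide +kernel) u
  have hy' := fun u : Fin 7 → K => toGL_eq_of (w := y) (ε := ![-1, 1, -1, -1, 1, -1, 1])
    (τ := ![3, 4, 2, 0, 1, 5, 6]) (by decide +kernel) u
  have hv : u' + toGL K x u' ∈ U := add_mem hu'U (hU' _ hxQ _ hu'U)
  have hw := add_mem hv (hU' _ hyQ _ hv)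
  have key : u' + toGL K x u' + toGL K y (u' + toGL K x u') = (4 * u' 6) • Pi.single 6 1 := by
    rw [hx', hy']
    funext j
    fin_cases j <;> simp
    ring
  rw [key] at hw
  have he : (Pi.single 6 1 : Fin 7 → K) ∈ U :=
    (Submodule.smul_mem_iff U (mul_ne_zero (by norm_num) hu6)).1 hw
  rw [eq_top_iff]
  intro v _
  rw [← Finset.univ_sum_single v]
  refine sum_mem fun i _ => ?_
  obtain ⟨k, hk⟩ := exists_toGL_pow_a_single (K := K) i
  have h1 := U.smul_mem (v i) (hk ▸ hU' _ (pow_mem ha k) _ he)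
  rwa [← Pi.single_smul, smul_eq_mul, mul_one] at h1

lemma isCompl_span_one_sumZero : IsCompl (Submodule.span K {(1 : Fin 7 → K)}) (sumZero K) := by
  constructor
  · rw [Submodule.disjoint_def]
    intro v hv hv0
    obtain ⟨c, rfl⟩ := Submodule.mem_span_singleton.1 hv
    rw [mem_sumZero] at hv0
    simp at hv0
    simp [hv0]
  · rw [codisjoint_iff, eq_top_iff]
    intro v _
    refine Submodule.mem_sup.2 ⟨((∑ i, v i) / 7) • 1,
      Submodule.smul_mem _ _ (Submodule.mem_span_singleton_self _),
      v - ((∑ i, v i) / 7) • 1, ?_, by simp⟩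
    rw [mem_sumZero]
    simp [Finset.sum_sub_distrib]
    ring

/-- The line of constant vectors as a subrepresentation. -/
def constantSubrep (K : Type) [Field K] : Subrepresentation (natRep (P K)) where
  toSubmodule := Submodule.span K {1}
  apply_mem_toSubmodule := by
    rintro ⟨g, hg⟩ v hv
    obtain ⟨σ, rfl⟩ := exists_of_mem_P hg
    obtain ⟨c, rfl⟩ := Submodule.mem_span_singleton.1 hv
    refine Submodule.mem_span_singleton.2 ⟨c, funext fun j => ?_⟩
    rw [natRep_apply, toGL_ofPerm_apply]
    rfl

/-- The hyperplane of vectors with coordinate sum zero as a subrepresentation. -/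
def sumZeroSubrep (K : Type) [Field K] : Subrepresentation (natRep (P K)) where
  toSubmodule := sumZero K
  apply_mem_toSubmodule := by
    rintro ⟨g, hg⟩ v hv
    obtain ⟨σ, rfl⟩ := exists_of_mem_P hg
    rw [mem_sumZero] at hv ⊢
    simp only [natRep_apply, toGL_ofPerm_apply]
    rw [Equiv.sum_comp, hv]

/-- On vectors `u` with coordinate sum zero, an element of the group ring of the stabilizer of the
last basis vector `e` in `⟨α̃, β̃, γ̃⟩` acts as `u ↦ 2 u_7 • (7 e - 1)`; here `1` is the all-ones
vector. The vectors `7 e_i - 1` span the hyperplane. -/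
lemma sumZero_le_of_invariant {U : Submodule K (Fin 7 → K)}
    (hU : ∀ w ∈ SignedPerm.P, ∀ u ∈ U, toGL K w u ∈ U) {u : Fin 7 → K} (hu : u ∈ U)
    (hu0 : u ≠ 0) (hUW : U ≤ sumZero K) : sumZero K ≤ U := by
  have ha := SignedPerm.a_mem_P
  obtain ⟨i, hi⟩ := Function.ne_iff.1 hu0
  obtain ⟨k, hk⟩ := exists_toGL_pow_a_apply u i
  set u' := toGL K (SignedPerm.a ^ k) u with hu'
  have hu'U : u' ∈ U := hU _ (pow_mem ha k) u hu
  have hu6 : u' 6 ≠ 0 := by rwa [hk]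
  have hsum := mem_sumZero.1 (hUW hu'U)
  simp only [Fin.sum_univ_seven] at hsum
  have hA : SignedPerm.A ∈ SignedPerm.P := SignedPerm.map_ofPerm_L ▸
    ⟨_, SignedPerm.LT_le (Subgroup.subset_closure (by simp)), rfl⟩
  have hB : SignedPerm.B ∈ SignedPerm.P := SignedPerm.map_ofPerm_L ▸
    ⟨_, SignedPerm.LT_le (Subgroup.subset_closure (by simp)), rfl⟩
  have hA' := fun u : Fin 7 → K => toGL_eq_of (w := SignedPerm.A) (ε := 1)
    (τ := ![1, 5, 3, 4, 2, 0, 6]) (by decide +kernel) u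
  have hB' := fun u : Fin 7 → K => toGL_eq_of (w := SignedPerm.B) (ε := 1)
    (τ := ![2, 1, 0, 5, 4, 3, 6]) (by decide +kernel) u
  have avg : ∀ v ∈ U, v + toGL K SignedPerm.A v + toGL K SignedPerm.A (toGL K SignedPerm.A v) ∈ U :=
    fun v hv => add_mem (add_mem hv (hU _ hA _ hv)) (hU _ hA _ (hU _ hA _ hv))
  have hv := avg _ hu'U
  have hw := add_mem (avg _ (hU _ hB _ hv)) hv
  set v := u' + toGL K SignedPerm.A u' + toGL K SignedPerm.A (toGL K SignedPerm.A u') with hvdef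
  have hv' : v = ![u' 0 + u' 1 + u' 5, u' 0 + u' 1 + u' 5, u' 2 + u' 3 + u' 4, u' 2 + u' 3 + u' 4,
      u' 2 + u' 3 + u' 4, u' 0 + u' 1 + u' 5, 3 * u' 6] := by
    rw [hvdef, hA', hA']
    funext j
    fin_cases j <;> simp <;> ring
  have key : toGL K SignedPerm.B v + toGL K SignedPerm.A (toGL K SignedPerm.B v) +
      toGL K SignedPerm.A (toGL K SignedPerm.A (toGL K SignedPerm.B v)) + v =
      (2 * u' 6) • ((7 : K) • Pi.single 6 1 - 1) := by
    rw [hA', hA', hB', hv']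
    funext j
    fin_cases j <;> simp <;> first | linear_combination 2 * hsum | ring
  rw [key] at hw
  have he : (7 : K) • Pi.single 6 1 - 1 ∈ U :=
    (Submodule.smul_mem_iff U (mul_ne_zero (by norm_num) hu6)).1 hw
  intro w hw0
  rw [mem_sumZero] at hw0
  have hmem : ∑ i, w i • ((7 : K) • Pi.single i 1 - 1 : Fin 7 → K) ∈ U := by
    refine sum_mem fun i _ => U.smul_mem _ ?_
    obtain ⟨k, hk⟩ := exists_toGL_pow_a_single (K := K) i
    have h1 := hU _ (pow_mem ha k) _ he
    rwa [map_sub, map_smul, hk, toGL_pow_a_one] at h1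
  have hw7 : ∑ i, w i • ((7 : K) • Pi.single i 1 - 1 : Fin 7 → K) = (7 : K) • w := by
    simp only [smul_sub, Finset.sum_sub_distrib, ← Finset.sum_smul, hw0, zero_smul, sub_zero]
    funext j
    simp [Finset.sum_apply, Pi.single_apply, mul_comm]
  rw [hw7] at hmem
  exact (Submodule.smul_mem_iff U (by norm_num)).1 hmem

theorem decomposesAsOneAddSix_P : DecomposesAsOneAddSix (P K) := by
  have hone : (1 : Fin 7 → K) ≠ 0 := one_ne_zero
  have h1 : Module.finrank K (Submodule.span K {(1 : Fin 7 → K)}) = 1 := finrank_span_singleton hone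
  have h6 : Module.finrank K (sumZero K) = 6 := by
    have := Submodule.finrank_add_eq_of_isCompl (isCompl_span_one_sumZero (K := K))
    rw [h1, Module.finrank_fin_fun] at this
    omega
  refine ⟨constantSubrep K, sumZeroSubrep K, isCompl_span_one_sumZero, h1, ⟨?_⟩, h6, ?_⟩
  · rintro ⟨g, hg⟩
    obtain ⟨σ, rfl⟩ := exists_of_mem_P hg
    ext ⟨v, hv⟩ : 1
    obtain ⟨c, rfl⟩ := Submodule.mem_span_singleton.1 hv
    refine Subtype.ext (funext fun j => ?_)
    change toGL K (SignedPerm.ofPerm σ) (c • 1) j = _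
    rw [toGL_ofPerm_apply]
    rfl
  · have hnt : Nontrivial (sumZero K) :=
      Module.nontrivial_of_finrank_pos (R := K) (by rw [h6]; norm_num)
    have : Nontrivial (sumZeroSubrep K).toSubmodule := hnt
    refine isIrreducible_of_forall _ fun U hU u hu hu0 => ?_
    have hle : sumZero K ≤ U.map (sumZero K).subtype := by
      refine sumZero_le_of_invariant ?_ (u := u) ⟨u, hu, rfl⟩ (fun h => hu0 (Subtype.ext h))
        (Submodule.map_subtype_le _ _)
      rintro w hw _ ⟨v, hv, rfl⟩
      exact ⟨_, hU ⟨toGL K w, map_P K ▸ ⟨w, hw, rfl⟩⟩ v hv, rfl⟩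
    rw [eq_top_iff]
    rintro ⟨v, hv⟩ -
    obtain ⟨v', hv', he⟩ := hle hv
    obtain rfl : v' = ⟨v, hv⟩ := Subtype.ext he
    exact hv'

end Representation

end Order1344

open Order1344 in
theorem mainTheorem4 :
    -- the group is the split extension of `2^3` by `PSL_2(7)`, acting faithfully on `2^3`
    (IsElementaryTwo (E8 ℝ) 3 ∧
      IsSplitExtension (G ℝ) (E8 ℝ) (P ℝ) ∧
      (∀ g ∈ P ℝ, (∀ e ∈ E8 ℝ, g * e = e * g) → g = 1)) ∧
    -- the five representatives are maximal subgroups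
    (∀ i, maxRep ℝ i ⋖ G ℝ) ∧
    -- they are pairwise not conjugate
    (∀ i j, i ≠ j → ¬ ConjugateIn (G ℝ) (maxRep ℝ i) (maxRep ℝ j)) ∧
    -- every maximal subgroup is conjugate to one of them
    (∀ M : Subgroup (GL7 ℝ), M ⋖ G ℝ → ∃ i, ConjugateIn (G ℝ) (maxRep ℝ i) M) ∧
    -- the first one is `2^3:7:3`, where `7:3` is the non-abelian group of order 21
    (IsSplitExtension (M1 ℝ) (E8 ℝ) (F21 ℝ) ∧
      IsSplitExtension (F21 ℝ) (Subgroup.zpowers (alphaT ℝ)) (Subgroup.zpowers (betaT ℝ)) ∧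
      orderOf (alphaT ℝ) = 7 ∧ orderOf (betaT ℝ) = 3 ∧ ¬ Commute (alphaT ℝ) (betaT ℝ)) ∧
    -- the second one is `2^3:S_4`
    (IsSplitExtension (M2 ℝ) (E8 ℝ) (S ℝ) ∧ Nonempty (S ℝ ≃* Equiv.Perm (Fin 4))) ∧
    -- the third one is `4:S_4:2 = (4:S_4):2`, where `4` is elementary abelian
    (IsElementaryTwo (E4 ℝ) 2 ∧ Nonempty (T ℝ ≃* Equiv.Perm (Fin 4)) ∧
      IsSplitExtension (E4 ℝ ⊔ T ℝ) (E4 ℝ) (T ℝ) ∧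
      orderOf (N1 ℝ) = 2 ∧
      IsSplitExtension (M3 ℝ) (E4 ℝ ⊔ T ℝ) (Subgroup.zpowers (N1 ℝ))) ∧
    -- the last two are complements of `2^3` isomorphic to `PSL_2(7)`
    (Nonempty (P ℝ ≃* Matrix.ProjectiveSpecialLinearGroup (Fin 2) (ZMod 7)) ∧
      Nonempty (Q ℝ ≃* Matrix.ProjectiveSpecialLinearGroup (Fin 2) (ZMod 7)) ∧
      IsSplitExtension (G ℝ) (E8 ℝ) (Q ℝ) ∧
      delta ℝ ∈ G ℝ ∧ gammaT ℝ * delta ℝ = N6 ℝ ∧ delta ℝ * gammaT ℝ = N6 ℝ) ∧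
    -- the first complement acts on the 7-space as `1 + 6`, over the reals and over the complexes
    (DecomposesAsOneAddSix (P ℝ) ∧ DecomposesAsOneAddSix (P ℂ)) ∧
    -- the second complement acts irreducibly, over the reals and over the complexes
    ((natRep (Q ℝ)).IsIrreducible ∧ (natRep (Q ℂ)).IsIrreducible) := by
  have inj := toGL_injective ℝ
  refine ⟨⟨?_, ?_, ?_⟩, ?_, ?_, ?_, ⟨?_, ?_, ?_, ?_, ?_⟩, ⟨?_, ?_⟩, ⟨?_, ?_, ?_, ?_, ?_⟩,
    ⟨?_, ?_, ?_, ?_, ?_, ?_⟩, ⟨decomposesAsOneAddSix_P, decomposesAsOneAddSix_P⟩,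
    isIrreducible_natRep_Q, isIrreducible_natRep_Q⟩
  · rw [← map_E]
    obtain ⟨e⟩ := SignedPerm.isElementaryTwo_E
    exact ⟨(SignedPerm.E.equivMapOfInjective _ inj).symm.trans e⟩
  · rw [← map_G, ← map_E, ← map_P]
    exact SignedPerm.isSplitExtension_P.map inj
  · rw [← map_E, ← map_P]
    rintro _ ⟨g, hg, rfl⟩ h
    rw [SignedPerm.eq_one_of_commute_E (SignedPerm.P_le_range_ofPerm hg) fun e he =>
      inj (by simpa using h _ ⟨e, he, rfl⟩), map_one]
  · intro i
    rw [← map_maxRep, ← map_G]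
    exact (covBy_map_iff inj).2 (SignedPerm.maxRep_covBy i)
  · intro i j hij h
    rw [← map_maxRep, ← map_maxRep, ← map_G] at h
    exact SignedPerm.not_conjugateIn_maxRep hij (h.of_map inj)
  · intro M hM
    rw [← map_G] at hM
    obtain ⟨N, rfl⟩ := exists_map_eq_of_le hM.lt.le
    obtain ⟨i, hi⟩ := SignedPerm.exists_conjugateIn_maxRep ((covBy_map_iff inj).1 hM)
    refine ⟨i, ?_⟩
    rw [← map_maxRep, ← map_G]
    exact hi.map _
  · rw [← map_M1, ← map_E, ← map_F]
    exact SignedPerm.isSplitExtension_M1.map inj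
  · rw [← map_F, ← toGL_a, ← toGL_b, ← MonoidHom.map_zpowers, ← MonoidHom.map_zpowers]
    exact SignedPerm.isSplitExtension_F.map inj
  · rw [← toGL_a, orderOf_injective _ inj, SignedPerm.orderOf_a]
  · rw [← toGL_b, orderOf_injective _ inj, SignedPerm.orderOf_b]
  · rw [← toGL_a, ← toGL_b, Commute, SemiconjBy, ← map_mul, ← map_mul, inj.eq_iff]
    decide +kernel
  · rw [← map_M2, ← map_E, ← map_S]
    exact SignedPerm.isSplitExtension_M2.map inj
  · rw [← map_S]
    obtain ⟨e⟩ := SignedPerm.nonempty_equiv_S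
    exact ⟨(SignedPerm.S.equivMapOfInjective _ inj).symm.trans e⟩
  · rw [← map_E4]
    obtain ⟨e⟩ := SignedPerm.isElementaryTwo_E4
    exact ⟨(SignedPerm.E4.equivMapOfInjective _ inj).symm.trans e⟩
  · rw [← map_T]
    obtain ⟨e⟩ := SignedPerm.nonempty_equiv_T
    exact ⟨(SignedPerm.T.equivMapOfInjective _ inj).symm.trans e⟩
  · rw [← map_E4, ← map_T, ← Subgroup.map_sup]
    exact SignedPerm.isSplitExtension_E4_sup_T.map inj
  · exact (orderOf_injective _ inj SignedPerm.n1).trans SignedPerm.orderOf_n1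
  · rw [← map_M3, ← map_E4, ← map_T, ← Subgroup.map_sup,
      show N1 ℝ = toGL ℝ SignedPerm.n1 from rfl, ← MonoidHom.map_zpowers]
    exact SignedPerm.isSplitExtension_M3.map inj
  · rw [← map_P]
    obtain ⟨e⟩ := SignedPerm.nonempty_equiv_P
    exact ⟨(SignedPerm.P.equivMapOfInjective _ inj).symm.trans e⟩
  · rw [← map_Q]
    obtain ⟨e⟩ := SignedPerm.nonempty_equiv_Q
    exact ⟨(SignedPerm.Q.equivMapOfInjective _ inj).symm.trans e⟩
  · rw [← map_G, ← map_E, ← map_Q]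
    exact SignedPerm.isSplitExtension_Q.map inj
  · rw [← map_G, ← toGL_d]
    exact ⟨_, SignedPerm.d_mem_G, rfl⟩
  · rw [← toGL_c, ← toGL_d, ← map_mul]
    exact congrArg (toGL ℝ) (by decide +kernel : SignedPerm.c * SignedPerm.d = SignedPerm.n6)
  · rw [← toGL_c, ← toGL_d, ← map_mul]
    exact congrArg (toGL ℝ) (by decide +kernel : SignedPerm.d * SignedPerm.c = SignedPerm.n6)
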